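/- Let $G$ be a finitely presented group, $\epsilon:G\to\langle t\rangle\cong\mathbb Z$ an epimorphism, $x\in G$ an element with $\epsilon(x)=t$, $K=\ker\epsilon$, and let $\mu$ be the automorphism $u\mapsto xux^{-1}$ of $K$. Let $N,r\ge 1$, and let $S_N$ act on $\{1,\dots,N\}$ on the right. Let $\rho:K\to S_N$ be a representation with transitive image that has period $r$, i.e. $\rho\circ\mu^r=\rho$. The order $\Delta_0(M)$ of a finitely generated module $M$ over $\mathbb Z[t^{\pm1}]$ is the greatest common divisor of the maximal minors of a presentation matrix of $M$ (columns corresponding to generators, rows to relations, with zero rows added if there are fewer rows than columns); it is defined up to multiplication by units $\pm t^k$. The Crowell group $K_\rho$ has generators ${}^iu$ ($1\le i\le N$, $u\in K$) and relations ${}^i(uv)=({}^iu)({}^{i\rho(u)}v)$. Its abelianization is a $\mathbb Z[s^{\pm1}]$-module with $s\,{}^iu={}^i(\mu^r(u))$, and $D_{\rho,r}(s)=\Delta_0(K_\rho^{\rm ab})$. Suppose that $\rho$ extends to a representation $\tilde\rho:G\to S_N$ with $\tilde\rho(x)^r=1$. Let $X$ be the standard $2$-complex of a finite presentation of $G$,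 let $X'$ be its infinite cyclic cover determined by $\epsilon$, and let $\widehat{X'}$ be the $N$-sheeted cover of $X'$ determined by $\rho$. Equivalently, $\widehat{X'}$ is the cover of $X$ with fibre $\mathbb Z\times\{1,\dots,N\}$, on which $g\in G$ acts on the right by $(\nu,i)\cdot g=(\nu+\epsilon(g),\,i\tilde\rho(g))$. The deck transformation $(\nu,i)\mapsto(\nu+1,i)$ makes $H_1(\widehat{X'};\mathbb Z)$ a $\mathbb Z[t^{\pm1}]$-module, and the (Kirk–Livingston) twisted Alexander polynomial is $\Delta_\rho(t)=\Delta_0(H_1(\widehat{X'};\mathbb Z))$. For $f(t)=c\prod_j(t-\xi_j)\in\mathbb C[t]$ put $f^{(r)}(t)=c^r\prod_j(t-\xi_j^r)$. Then both orders exist, and if $\Delta_\rho$ is represented by a polynomial in $\mathbb Z[t]$, then $\Delta_\rho^{(r)}$ has integer coefficients and $$D_{\rho,r}(s)=\Delta_\rho^{(r)}(s)\cdot(s-1)^{N-1}$$ up to multiplication by units $\pm s^k$ of $\mathbb Z[s^{\pm1}]$. -/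

import Mathlib

noncomputable section

open scoped LaurentPolynomial

namespace TwistedAlexander

/-! ### Orders of modules -/

/-- `A` is a presentation matrix of the `R`-module `M`: the columns correspond to generators
`v j` of `M`, and the rows generate the module of all relations between them. -/
def IsPresentationMatrix {R : Type*} [CommRing R] (M : Type*) [AddCommGroup M] [Module R M]
    {m n : ℕ} (A : Matrix (Fin m) (Fin n) R) : Prop :=
  ∃ v : Fin n → M, Submodule.span R (Set.range v) = ⊤ ∧
    ∀ c : Fin n → R, ∑ j, c j • v j = 0 ↔ c ∈ Submodule.span R (Set.range fun i => A i)

/-- `d` is a greatest common divisor of the `n × n` minors of the `m × n` matrix `A`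
(if `m < n`, which amounts to adding zero rows, this says `d = 0`). -/
def IsGcdOfMaximalMinors {R : Type*} [CommRing R] {m n : ℕ} (A : Matrix (Fin m) (Fin n) R)
    (d : R) : Prop :=
  (∀ f : Fin n → Fin m, d ∣ (A.submatrix f id).det) ∧
    ∀ e : R, (∀ f : Fin n → Fin m, e ∣ (A.submatrix f id).det) → e ∣ d

/-- `d` is an order `Δ₀(M)` of the `R`-module `M`: a greatest common divisor of the maximal minors
of a presentation matrix of `M`. -/
def IsOrder (R : Type*) [CommRing R] (M : Type*) [AddCommGroup M] [Module R M] (d : R) : Prop :=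
  ∃ (m n : ℕ) (A : Matrix (Fin m) (Fin n) R), IsPresentationMatrix M A ∧ IsGcdOfMaximalMinors A d

/-- For `f = c ∏ (t - ξⱼ)`, the polynomial `f⁽ʳ⁾ = c ^ r ∏ (t - ξⱼ ^ r)`. -/
def powRoots (r : ℕ) (f : Polynomial ℂ) : Polynomial ℂ :=
  Polynomial.C (f.leadingCoeff ^ r) *
    (f.roots.map fun ξ => Polynomial.X - Polynomial.C (ξ ^ r)).prod

/-! ### The Laurent polynomial module of an automorphism -/

/-- The abelian group `A`, to be regarded as a `ℤ[s, s⁻¹]`-module on which `s` acts by the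
automorphism `φ`. -/
def LaurentModule {A : Type*} [AddCommGroup A] (_φ : A ≃+ A) : Type _ := A

instance {A : Type*} [AddCommGroup A] (φ : A ≃+ A) : AddCommGroup (LaurentModule φ) :=
  inferInstanceAs (AddCommGroup A)

/-- The automorphism `φ`, as a unit of the endomorphism ring. -/
def autUnit {A : Type*} [AddCommGroup A] (φ : A ≃+ A) : (Module.End ℤ A)ˣ where
  val := φ.toAddMonoidHom.toIntLinearMap
  inv := φ.symm.toAddMonoidHom.toIntLinearMap
  val_inv := by ext a; exact φ.apply_symm_apply a
  inv_val := by ext a; exact φ.symm_apply_apply a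

/-- The ring homomorphism `ℤ[s, s⁻¹] → End A` that maps `s` to `φ`. -/
def laurentHom {A : Type*} [AddCommGroup A] (φ : A ≃+ A) : ℤ[T;T⁻¹] →+* Module.End ℤ A :=
  (AddMonoidAlgebra.lift ℤ (Module.End ℤ A) ℤ
    ((Units.coeHom (Module.End ℤ A)).comp
      (zpowersHom (Module.End ℤ A)ˣ (autUnit φ)))).toRingHom

instance {A : Type*} [AddCommGroup A] (φ : A ≃+ A) : Module ℤ[T;T⁻¹] (LaurentModule φ) :=
  Module.compHom A (laurentHom φ)

theorem laurentModule_T_smul {A : Type*} [AddCommGroup A] (φ : A ≃+ A) (a : A) :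
    (LaurentPolynomial.T 1 : ℤ[T;T⁻¹]) • (show LaurentModule φ from a) = φ a := by
  change laurentHom φ (LaurentPolynomial.T 1) a = φ a
  have h : laurentHom φ (LaurentPolynomial.T 1) = autUnit φ := by
    change AddMonoidAlgebra.lift ℤ (Module.End ℤ A) ℤ
      ((Units.coeHom (Module.End ℤ A)).comp (zpowersHom (Module.End ℤ A)ˣ (autUnit φ)))
        (LaurentPolynomial.T 1) = autUnit φ
    rw [LaurentPolynomial.T, AddMonoidAlgebra.lift_single]
    simp
  rw [h]
  rfl

/-! ### Augmented group systems and permutation representations -/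

/-- An augmentation `ε : G → ⟨t⟩ ≅ ℤ` with a distinguished element `x` such that `ε x = t`
(so `ε` is onto).  Finite presentability of `G` is given separately, by a
`FinPresentation`. -/
structure AugmentedGroup (G : Type*) [Group G] where
  ε : G →* Multiplicative ℤ
  x : G
  ε_x : ε x = Multiplicative.ofAdd 1

namespace AugmentedGroup

variable {G : Type*} [Group G] (𝒢 : AugmentedGroup G)

/-- The kernel of the augmentation. -/
abbrev K : Subgroup G := 𝒢.ε.ker

/-- The automorphism `u ↦ x u x⁻¹` of `K`. -/
def μ : MulAut 𝒢.K := MulAut.conjNormal 𝒢.x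

end AugmentedGroup

/-- The symmetric group on `N` symbols, multiplied so that it acts on the symbols on the right:
`σ * τ` is `σ` followed by `τ`. -/
abbrev SymR (N : ℕ) : Type := (Equiv.Perm (Fin N))ᵐᵒᵖ

/-- The right action `i σ`. -/
def SymR.act {N : ℕ} (i : Fin N) (σ : SymR N) : Fin N := σ.unop i

/-! ### The Crowell group -/

/-- The relators of the relations `ⁱ(uv) = ⁱu ⁱᵘv`. -/
def crowellRels {K : Type*} [Group K] {N : ℕ} (ρ : K →* SymR N) : Set (FreeGroup (Fin N × K)) :=
  {w | ∃ (i : Fin N) (u v : K), w = FreeGroup.of (i, u * v) *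
    (FreeGroup.of (i, u) * FreeGroup.of (SymR.act i (ρ u), v))⁻¹}

/-- The Crowell group `K_ρ`, generated by the symbols `ⁱu` subject to `ⁱ(uv) = ⁱu ⁱᵘv`. -/
abbrev CrowellGroup {K : Type*} [Group K] {N : ℕ} (ρ : K →* SymR N) : Type _ :=
  PresentedGroup (crowellRels ρ)

/-- An automorphism `α` of `K` with `ρ ∘ α = ρ` induces the endomorphism `ⁱu ↦ ⁱ(α u)`. -/
def crowellMap {K : Type*} [Group K] {N : ℕ} (ρ : K →* SymR N) (α : MulAut K)
    (h : ∀ u, ρ (α u) = ρ u) : CrowellGroup ρ →* CrowellGroup ρ :=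
  PresentedGroup.toGroup
    (f := fun p : Fin N × K => (PresentedGroup.of (p.1, α p.2) : CrowellGroup ρ)) (by
      rintro _ ⟨i, u, v, rfl⟩
      have key : (PresentedGroup.mk (crowellRels ρ)) (FreeGroup.of (i, α u * α v) *
          (FreeGroup.of (i, α u) * FreeGroup.of (SymR.act i (ρ (α u)), α v))⁻¹) = 1 :=
        PresentedGroup.one_of_mem ⟨i, α u, α v, rfl⟩
      rw [h] at key
      simpa [PresentedGroup.of] using key)

theorem crowellMap_of {K : Type*} [Group K] {N : ℕ} (ρ : K →* SymR N) (α : MulAut K)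
    (h : ∀ u, ρ (α u) = ρ u) (i : Fin N) (u : K) :
    crowellMap ρ α h (PresentedGroup.of (i, u)) = PresentedGroup.of (i, α u) := by
  simp [crowellMap]

/-- The automorphism `ⁱu ↦ ⁱ(α u)` of `K_ρ`. -/
def crowellAut {K : Type*} [Group K] {N : ℕ} (ρ : K →* SymR N) (α : MulAut K)
    (h : ∀ u, ρ (α u) = ρ u) : CrowellGroup ρ ≃* CrowellGroup ρ :=
  have h' : ∀ u, ρ (α⁻¹ u) = ρ u := fun u => by
    rw [← h (α⁻¹ u), MulAut.apply_inv_self]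
  MonoidHom.toMulEquiv (crowellMap ρ α h) (crowellMap ρ α⁻¹ h')
    (by ext ⟨i, u⟩; simp [crowellMap_of])
    (by ext ⟨i, u⟩; simp [crowellMap_of])

/-- The `ℤ[s, s⁻¹]`-module `K_ρ^ab` of a representation `ρ` with period `r`, i.e. with
`σ ^ r ρ = ρ` where `(σ ρ) u = ρ (μ u)`; here `s ⁱu = ⁱ(μ ^ r u)`. -/
abbrev CrowellModule {G : Type*} [Group G] (𝒢 : AugmentedGroup G) {N : ℕ}
    (ρ : 𝒢.K →* SymR N) (r : ℕ) (hper : ∀ u : 𝒢.K, ρ ((𝒢.μ ^ r) u) = ρ u) : Type _ :=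
  LaurentModule (MulEquiv.toAdditive (crowellAut ρ (𝒢.μ ^ r) hper).abelianizationCongr)

/-! ### The cover `X̂'` and its first homology -/

/-- A finite presentation of `G`, with generators indexed by `Fin n` and relators by `Fin m`. -/
structure FinPresentation (G : Type*) [Group G] where
  n : ℕ
  m : ℕ
  rel : Fin m → FreeGroup (Fin n)
  proj : FreeGroup (Fin n) →* G
  surj : Function.Surjective proj
  ker_eq : proj.ker = Subgroup.normalClosure (Set.range rel)

/-- The first homology `ker d₁ / im d₂` of a chain complex `C₂ → C₁ → C₀`. -/
abbrev H1 {R C₂ C₁ C₀ : Type*} [CommRing R] [AddCommGroup C₂] [AddCommGroup C₁] [AddCommGroup C₀]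
    [Module R C₂] [Module R C₁] [Module R C₀] (d₂ : C₂ →ₗ[R] C₁) (d₁ : C₁ →ₗ[R] C₀) : Type _ :=
  LinearMap.ker d₁ ⧸ (LinearMap.range d₂).submoduleOf (LinearMap.ker d₁)

section Cover

variable {G : Type*} [Group G] (𝒢 : AugmentedGroup G) {N : ℕ} (P : FinPresentation G)
  (ρ : G →* SymR N)

/-! Let `X` be the standard 2-complex of the presentation `P`.  The cover `X̂'` is the cover of
`X` whose fibre is the right `G`-set `ℤ × [1, N]`, with `(ν, i) g = (ν + ε g, i ρ(g))`: it is the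
`N`-sheeted cover, determined by the restriction of `ρ` to `K`, of the infinite cyclic cover `X'`
of `X` determined by `ε`.  Over every cell of `X` it has one cell for every `(ν, i)`, and the
deck transformation `t` maps the cell labelled `(ν, i)` to the one labelled `(ν + 1, i)`.  So the
cellular chain group in each degree is the free `ℤ[t, t⁻¹]`-module on the pairs (cell of `X`, `i`);
the cell labelled `(ν, i)` is `t ^ ν` times the basis element with index `i`. -/

/-- The action of `g : G` on the fibre `ℤ × [1, N]`. -/
def fibreAct (v : ℤ × Fin N) (g : G) : ℤ × Fin N :=
  (v.1 + Multiplicative.toAdd (𝒢.ε g), SymR.act v.2 (ρ g))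

/-- The 0-chains of `X̂'`. -/
abbrev Chain0 (N : ℕ) : Type := Fin N → ℤ[T;T⁻¹]

/-- The 1-chains of `X̂'`. -/
abbrev Chain1 {G : Type*} [Group G] (P : FinPresentation G) (N : ℕ) : Type :=
  Fin P.n × Fin N → ℤ[T;T⁻¹]

/-- The 2-chains of `X̂'`. -/
abbrev Chain2 {G : Type*} [Group G] (P : FinPresentation G) (N : ℕ) : Type :=
  Fin P.m × Fin N → ℤ[T;T⁻¹]

/-- The vertex of `X̂'` labelled `v`. -/
def vertex (v : ℤ × Fin N) : Chain0 N := Pi.single v.2 (LaurentPolynomial.T v.1)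

/-- The lift starting at the vertex `v` of the 1-cell of the generator `a`. -/
def edge (a : Fin P.n) (v : ℤ × Fin N) : Chain1 P N :=
  Pi.single (a, v.2) (LaurentPolynomial.T v.1)

/-- The 1-chain of the edge path that lifts a word to `X̂'`, with initial vertex `v`; in words,
`(a, true)` is a letter `a` and `(a, false)` is a letter `a⁻¹`. -/
def pathChain : List (Fin P.n × Bool) → ℤ × Fin N → Chain1 P N
  | [], _ => 0
  | (a, true) :: w, v =>
      edge P a v + pathChain w (fibreAct 𝒢 ρ v (P.proj (FreeGroup.of a)))
  | (a, false) :: w, v =>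
      -edge P a (fibreAct 𝒢 ρ v (P.proj (FreeGroup.of a))⁻¹) +
        pathChain w (fibreAct 𝒢 ρ v (P.proj (FreeGroup.of a))⁻¹)

/-- The boundary of a 1-cell is its final vertex minus its initial vertex. -/
def boundary1 : Chain1 P N →ₗ[ℤ[T;T⁻¹]] Chain0 N :=
  Fintype.linearCombination ℤ[T;T⁻¹] fun p : Fin P.n × Fin N =>
    vertex (fibreAct 𝒢 ρ (0, p.2) (P.proj (FreeGroup.of p.1))) - vertex (0, p.2)

/-- The boundary of a 2-cell is the lift of the relator along which the cell is attached. -/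
def boundary2 : Chain2 P N →ₗ[ℤ[T;T⁻¹]] Chain1 P N :=
  Fintype.linearCombination ℤ[T;T⁻¹] fun p : Fin P.m × Fin N =>
    pathChain 𝒢 P ρ (P.rel p.1).toWord (0, p.2)

theorem fibreAct_mul (v : ℤ × Fin N) (g h : G) :
    fibreAct 𝒢 ρ v (g * h) = fibreAct 𝒢 ρ (fibreAct 𝒢 ρ v g) h := by
  simp [fibreAct, SymR.act, add_assoc]

theorem fibreAct_one (v : ℤ × Fin N) : fibreAct 𝒢 ρ v 1 = v := by
  simp [fibreAct, SymR.act]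

theorem boundary1_edge (a : Fin P.n) (v : ℤ × Fin N) :
    boundary1 𝒢 P ρ (edge P a v) =
      vertex (fibreAct 𝒢 ρ v (P.proj (FreeGroup.of a))) - vertex v := by
  rw [boundary1, edge, Fintype.linearCombination_apply_single, smul_sub]
  simp only [vertex, fibreAct, ← Pi.single_smul, smul_eq_mul, ← LaurentPolynomial.T_add,
    zero_add, add_zero]

theorem boundary1_pathChain (w : List (Fin P.n × Bool)) (v : ℤ × Fin N) :
    boundary1 𝒢 P ρ (pathChain 𝒢 P ρ w v) =
      vertex (fibreAct 𝒢 ρ v (P.proj (FreeGroup.mk w))) - vertex v := by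
  induction w generalizing v with
  | nil => simp [pathChain, ← FreeGroup.one_eq_mk, fibreAct_one]
  | cons c w ih =>
    obtain ⟨a, b⟩ := c
    have hmk : (FreeGroup.mk ((a, b) :: w)) = FreeGroup.mk [(a, b)] * FreeGroup.mk w := by
      simp
    rw [hmk, map_mul, fibreAct_mul]
    cases b
    · have h1 : FreeGroup.mk [(a, false)] = (FreeGroup.of a)⁻¹ := by
        simp [FreeGroup.of, FreeGroup.invRev]
      have h2 : fibreAct 𝒢 ρ (fibreAct 𝒢 ρ v (P.proj (FreeGroup.of a))⁻¹)
          (P.proj (FreeGroup.of a)) = v := by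
        rw [← fibreAct_mul, inv_mul_cancel, fibreAct_one]
      rw [pathChain, map_add, map_neg, boundary1_edge, ih, h1, h2, map_inv]
      abel
    · have h1 : FreeGroup.mk [(a, true)] = FreeGroup.of a := rfl
      rw [pathChain, map_add, boundary1_edge, ih, h1]
      abel

/-- The boundary of a boundary vanishes. -/
theorem boundary1_boundary2 (c : Chain2 P N) :
    boundary1 𝒢 P ρ (boundary2 𝒢 P ρ c) = 0 := by
  have hrel : ∀ k, P.proj (P.rel k) = 1 := fun k => by
    rw [← MonoidHom.mem_ker, P.ker_eq]
    exact Subgroup.subset_normalClosure ⟨k, rfl⟩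
  simp [boundary2, Fintype.linearCombination_apply, boundary1_pathChain, FreeGroup.mk_toWord,
    hrel, fibreAct_one]

/-- The `ℤ[t, t⁻¹]`-module `H₁(X̂'; ℤ)`: the 1-cycles modulo the boundaries. -/
abbrev CoverH1 : Type := H1 (boundary2 𝒢 P ρ) (boundary1 𝒢 P ρ)

end Cover

end TwistedAlexander

end

/-! Write R = ℤ[s^±1]. Geometrically, ⁱu is the class of the lift of u starting at the vertex (0,
i), and K_ρ^ab is the first homology of X̂' relative to the N vertices at level 0. Sending ⁱu to its
boundary [iρ(u)] - [i] therefore gives an exact sequence 0 → H₁(X̂') → K_ρ^ab → ℤ^N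
(`chainClass_exact`). Here s acts on H₁ as t^r, because conjugation by x^r is μ^r on K and x^r fixes
every sheet (`liftClass_add_period`). By transitivity the image of the boundary is the lattice of
vectors with sum zero, on which s acts trivially, so it is (R/(s-1))^(N-1) (`exists_complement`).

The formula then follows from three facts. An extension of (R/p)^k by a module multiplies the order
of the module by p^k (`IsDetGcd.relModule_sumElim`). Restriction of scalars along s ↦ t^r replaces
an order by its norm (`IsDetGcd.associated_norm`): for a square presentation matrix this is the
determinant formula for commuting blocks, and in general one works at one prime p of R at a time,
where relation modules over the larger unique factorization domain become generated by as many
elements as there are columns. Finally, the norm of f(t) is det f(M) for a matrix M with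
characteristic polynomial X^r - s, and factoring f over ℂ turns this into ±f^(r)(s)
(`exists_map_eq_powRoots`).

Orders are handled as greatest common divisors of the determinants of all square matrices with rows
in the relation module. This form needs no choice of relations, and `detDvd_relModule_iff` makes it
independent of the generators. -/

noncomputable section

open scoped LaurentPolynomial

namespace TwistedAlexander

/-! ### Determinants of matrices whose rows lie in a submodule -/

section DetDvd

variable {R : Type*} [CommRing R] {ι κ : Type*} [Fintype ι] [DecidableEq ι] [Fintype κ]
  [DecidableEq κ]

/-- `d` divides the determinant of every square matrix with rows in `W`. -/
def DetDvd (W : Submodule R (ι → R)) (d : R) : Prop :=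
  ∀ C : Matrix ι ι R, (∀ i, C i ∈ W) → d ∣ C.det

/-- `d` is a greatest common divisor of the determinants of the square matrices with rows
in `W`. -/
def IsDetGcd (W : Submodule R (ι → R)) (d : R) : Prop :=
  DetDvd W d ∧ ∀ e, DetDvd W e → e ∣ d

theorem IsDetGcd.associated [IsDomain R] {W : Submodule R (ι → R)} {d d' : R}
    (h : IsDetGcd W d) (h' : IsDetGcd W d') : Associated d d' :=
  associated_of_dvd_dvd (h'.2 _ h.1) (h.2 _ h'.1)

/-- A gcd is compatible with scaling by q: once the common factor c of e and q is removed, the rest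
of e is coprime to the rest of q and must divide each determinant. -/
theorem IsDetGcd.dvd_mul [IsDomain R] [UniqueFactorizationMonoid R] {W : Submodule R (ι → R)}
    {d e q : R} (h : IsDetGcd W d) (hq : q ≠ 0)
    (he : ∀ C : Matrix ι ι R, (∀ i, C i ∈ W) → e ∣ q * C.det) : e ∣ q * d := by
  obtain ⟨e', q', c, hcop, he', hq'⟩ := UniqueFactorizationMonoid.exists_reduced_factors' e q hq
  have hc : c ≠ 0 := by
    rintro rfl
    simp [← hq'] at hq
  rw [← he', ← hq', mul_assoc]
  refine mul_dvd_mul_left c (Dvd.dvd.mul_left (h.2 e' fun C hC => ?_) q')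
  have := he C hC
  rw [← he', ← hq', mul_assoc, mul_dvd_mul_iff_left hc] at this
  exact hcop.dvd_of_dvd_mul_left this

theorem DetDvd.comap_equiv {W : Submodule R (ι → R)} {d : R} (h : DetDvd W d) (σ : ι ≃ κ) :
    DetDvd (W.comap (LinearMap.funLeft R R σ)) d := by
  intro E hE
  rw [← Matrix.det_submatrix_equiv_self σ E]
  exact h _ fun i => hE (σ i)

theorem DetDvd.comap_succ {n : ℕ} {W : Submodule R (Fin n → R)} {d : R} (h : DetDvd W d) :
    DetDvd (W.comap (LinearMap.funLeft R R Fin.succ)) d := by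
  intro E hE
  rw [Matrix.det_succ_column_zero]
  exact Finset.dvd_sum fun i _ => Dvd.dvd.mul_left (h _ fun j => hE (i.succAbove j)) _

theorem DetDvd.comap_addNat {n : ℕ} {W : Submodule R (Fin n → R)} {d : R} (h : DetDvd W d)
    (k : ℕ) : DetDvd (W.comap (LinearMap.funLeft R R fun i : Fin n => i.addNat k)) d := by
  induction k with
  | zero => exact h
  | succ k ih => exact ih.comap_succ

/-- Extra columns do not affect the divisibility of the determinants (Laplace expansion). -/
theorem DetDvd.comap_inr {W : Submodule R (ι → R)} {d : R} (h : DetDvd W d) :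
    DetDvd (W.comap (LinearMap.funLeft R R (Sum.inr : ι → κ ⊕ ι))) d := by
  have e := Fintype.equivFin ι
  have f := Fintype.equivFin κ
  -- Number the columns so that those of κ come first, and expand along them one at a time.
  have h1 := (h.comap_equiv e).comap_addNat (Fintype.card κ)
  let σ : Fin (Fintype.card ι + Fintype.card κ) ≃ κ ⊕ ι :=
    ((finCongr (add_comm _ _)).trans finSumFinEquiv.symm).trans (Equiv.sumCongr f.symm e.symm)
  have h2 := h1.comap_equiv σ
  intro E hE
  refine h2 E fun i => ?_
  have : ∀ j : ι, σ ((e j).addNat (Fintype.card κ)) = Sum.inr j := by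
    intro j
    have : finCongr (add_comm (Fintype.card ι) (Fintype.card κ)) ((e j).addNat (Fintype.card κ))
        = finSumFinEquiv (Sum.inr (e j)) := by
      ext; simp
    simp [σ, this]
  have hi := hE i
  simp only [Submodule.mem_comap] at hi ⊢
  convert hi using 1
  ext j
  simp [LinearMap.funLeft_apply, this]

end DetDvd

/-! ### Relation modules and orders -/

section Relations

variable {R : Type*} [CommRing R] {M : Type*} [AddCommGroup M] [Module R M]
  {ι κ : Type*} [Fintype ι] [DecidableEq ι] [Fintype κ] [DecidableEq κ]

/-- The module of linear relations between the elements `v i`. -/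
def relModule (R : Type*) [CommRing R] {M : Type*} [AddCommGroup M] [Module R M]
    {ι : Type*} [Fintype ι] (v : ι → M) : Submodule R (ι → R) :=
  LinearMap.ker (Fintype.linearCombination R v)

omit [DecidableEq ι] in
theorem mem_relModule {v : ι → M} {c : ι → R} : c ∈ relModule R v ↔ ∑ i, c i • v i = 0 := by
  simp [relModule, Fintype.linearCombination_apply]

/-! ### Adding generators: extensions by copies of R/p, and redundant generators -/

section Extension

variable {v : ι → M} {w : κ → M} {p : R} {Q : Matrix κ ι R}

/-- Each relation has w-coefficients divisible by p, so p • w can be rewritten in terms of v. This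
factors E as X times a block triangular matrix of determinant p^κ, and the v-columns of X are
relations among v alone. -/
theorem DetDvd.relModule_sumElim {d : R} (hQ : ∀ k, p • w k = ∑ j, Q k j • v j)
    (hp : ∀ c ∈ relModule R (Sum.elim w v), ∀ k, p ∣ c (Sum.inl k))
    (h : DetDvd (relModule R v) d) :
    DetDvd (relModule R (Sum.elim w v)) (p ^ Fintype.card κ * d) := by
  intro E hE
  choose F hF using fun i k => hp _ (hE i) k
  let X : Matrix (κ ⊕ ι) (κ ⊕ ι) R := fun i => Sum.elim (fun k => F i k)
    (fun j => E i (Sum.inr j) + ∑ k, F i k * Q k j)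
  have hmul : E = X * Matrix.fromBlocks (p • (1 : Matrix κ κ R)) (-Q) 0 1 := by
    ext i j
    rw [Matrix.mul_apply, Fintype.sum_sum_type]
    rcases j with j | j
    · simp [X, hF, Matrix.one_apply, mul_comm]
    · simp [X, Matrix.one_apply]
  have hdet : E.det = p ^ Fintype.card κ * X.det := by
    rw [hmul, Matrix.det_mul, Matrix.det_fromBlocks_zero₂₁]
    simp [mul_comm]
  rw [hdet]
  refine mul_dvd_mul_left _ (h.comap_inr X fun i => ?_)
  rw [Submodule.mem_comap, mem_relModule]
  have := mem_relModule.1 (hE i)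
  rw [Fintype.sum_sum_type] at this
  simp only [Sum.elim_inl, Sum.elim_inr, hF, mul_comm p, mul_smul, hQ] at this
  rw [← this]
  simp only [LinearMap.funLeft_apply, X, Sum.elim_inr, add_smul, Finset.sum_add_distrib,
    Finset.sum_smul, Finset.smul_sum, mul_smul]
  rw [add_comm, Finset.sum_comm]

/-- The relations expressing p • w through v, stacked on C, form a block triangular matrix with
determinant p^κ det C. -/
theorem DetDvd.dvd_of_relModule_sumElim {e : R} (hQ : ∀ k, p • w k = ∑ j, Q k j • v j)
    (h : DetDvd (relModule R (Sum.elim w v)) e) (C : Matrix ι ι R)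
    (hC : ∀ i, C i ∈ relModule R v) : e ∣ p ^ Fintype.card κ * C.det := by
  have := h (Matrix.fromBlocks (p • (1 : Matrix κ κ R)) (-Q) 0 C) ?_
  · rw [Matrix.det_fromBlocks_zero₂₁] at this
    simpa using this
  · rintro (k | i)
    · rw [mem_relModule, Fintype.sum_sum_type]
      simp [Matrix.one_apply, hQ]
    · rw [mem_relModule, Fintype.sum_sum_type]
      simpa using mem_relModule.1 (hC i)

/-- In an extension of `(R ⧸ p) ^ κ`, orders get multiplied by `p ^ κ`. -/
theorem IsDetGcd.relModule_sumElim [IsDomain R] [UniqueFactorizationMonoid R] {d : R} (hp0 : p ≠ 0)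
    (hQ : ∀ k, p • w k = ∑ j, Q k j • v j)
    (hp : ∀ c ∈ relModule R (Sum.elim w v), ∀ k, p ∣ c (Sum.inl k))
    (h : IsDetGcd (relModule R v) d) :
    IsDetGcd (relModule R (Sum.elim w v)) (p ^ Fintype.card κ * d) := by
  refine ⟨h.1.relModule_sumElim hQ hp, fun e he => ?_⟩
  exact h.dvd_mul (pow_ne_zero _ hp0) fun C hC => he.dvd_of_relModule_sumElim hQ C hC

/-- The case p = 1: redundant generators change nothing. -/
theorem detDvd_relModule_sumElim_iff (hv : Submodule.span R (Set.range v) = ⊤) {d : R} :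
    DetDvd (relModule R (Sum.elim w v)) d ↔ DetDvd (relModule R v) d := by
  have : ∀ k, ∃ q : ι → R, (1 : R) • w k = ∑ j, q j • v j := fun k => by
    have : w k ∈ Submodule.span R (Set.range v) := hv ▸ Submodule.mem_top
    obtain ⟨q, hq⟩ := (Submodule.mem_span_range_iff_exists_fun R).1 this
    exact ⟨q, by rw [one_smul, hq]⟩
  choose Q hQ using this
  constructor
  · intro h C hC
    simpa using h.dvd_of_relModule_sumElim (p := 1) (Q := Q) hQ C hC
  · intro h
    simpa using h.relModule_sumElim (w := w) (p := 1) (Q := Q) hQ fun _ _ _ => one_dvd _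

theorem DetDvd.relModule_sumElim_swap {d : R}
    (h : DetDvd (relModule R (Sum.elim w v)) d) : DetDvd (relModule R (Sum.elim v w)) d := by
  intro E hE
  refine h.comap_equiv (Equiv.sumComm κ ι) E fun i => ?_
  rw [Submodule.mem_comap, mem_relModule]
  have := mem_relModule.1 (hE i)
  simp only [Fintype.sum_sum_type, LinearMap.funLeft_apply, Equiv.sumComm_apply, Sum.swap_inl,
    Sum.swap_inr, Sum.elim_inl, Sum.elim_inr] at this ⊢
  rw [← this, add_comm]

/-- Both families are compared with their union, in which either one makes the other redundant. -/
theorem detDvd_relModule_iff (hv : Submodule.span R (Set.range v) = ⊤)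
    (hw : Submodule.span R (Set.range w) = ⊤) {d : R} :
    DetDvd (relModule R v) d ↔ DetDvd (relModule R w) d := by
  rw [← detDvd_relModule_sumElim_iff (w := w) hv, ← detDvd_relModule_sumElim_iff (w := v) hw]
  exact ⟨DetDvd.relModule_sumElim_swap, DetDvd.relModule_sumElim_swap⟩

end Extension

theorem IsDetGcd.relModule_congr {v : ι → M} {w : κ → M} {d : R}
    (h : IsDetGcd (relModule R v) d) (hv : Submodule.span R (Set.range v) = ⊤)
    (hw : Submodule.span R (Set.range w) = ⊤) : IsDetGcd (relModule R w) d :=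
  ⟨(detDvd_relModule_iff hv hw).1 h.1, fun _ he => h.2 _ ((detDvd_relModule_iff hv hw).2 he)⟩

/-- By multilinearity, a determinant with rows in the span is a linear combination of the maximal
minors of A. -/
theorem detDvd_span_range_iff {m n : ℕ} {A : Matrix (Fin m) (Fin n) R} {d : R} :
    DetDvd (Submodule.span R (Set.range fun i => A i)) d ↔
      ∀ f : Fin n → Fin m, d ∣ (A.submatrix f id).det := by
  constructor
  · exact fun h f => h _ fun i => Submodule.subset_span ⟨f i, rfl⟩
  · intro h C hC
    choose B hB using fun i => (Submodule.mem_span_range_iff_exists_fun R).1 (hC i)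
    have : C = fun i => ∑ k, B i k • A k := funext fun i => (hB i).symm
    have h2 : C.det = ∑ f : Fin n → Fin m, (∏ i, B i (f i)) • (A.submatrix f id).det := by
      rw [this]
      have := (Matrix.detRowAlternating (n := Fin n) (R := R)).toMultilinearMap.map_sum
        (fun (i : Fin n) (k : Fin m) => B i k • A k)
      refine this.trans (Finset.sum_congr rfl fun f _ => ?_)
      exact (Matrix.detRowAlternating (n := Fin n) (R := R)).toMultilinearMap.map_smul_univ
        (fun i => B i (f i)) (fun i => A (f i))
    rw [h2]
    exact Finset.dvd_sum fun f _ => (h f).mul_left _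

/-- The order of a module can be computed from any finite generating family. -/
theorem IsOrder.isDetGcd {d : R} (h : IsOrder R M d) {v : ι → M}
    (hv : Submodule.span R (Set.range v) = ⊤) : IsDetGcd (relModule R v) d := by
  obtain ⟨m, n, A, ⟨w, hw, hA⟩, hd⟩ := h
  refine IsDetGcd.relModule_congr (v := w) ?_ hw hv
  have : relModule R w = Submodule.span R (Set.range fun i => A i) :=
    Submodule.ext fun c => mem_relModule.trans (hA c)
  rw [this]
  exact ⟨detDvd_span_range_iff.2 hd.1, fun e he => hd.2 e (detDvd_span_range_iff.1 he)⟩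

/-- A finite family in a unique factorization domain has a greatest common divisor. -/
theorem exists_finset_gcd [IsDomain R] [UniqueFactorizationMonoid R] {α : Type*} (s : Finset α)
    (f : α → R) : ∃ d, (∀ a ∈ s, d ∣ f a) ∧ ∀ e, (∀ a ∈ s, e ∣ f a) → e ∣ d := by
  let _ := UniqueFactorizationMonoid.strongNormalizationMonoid (α := R)
  let _ := UniqueFactorizationMonoid.toNormalizedGCDMonoid R
  exact ⟨s.gcd f, fun a => Finset.gcd_dvd, fun e => Finset.dvd_gcd⟩

theorem exists_isDetGcd_of_fin [IsDomain R] [UniqueFactorizationMonoid R] [IsNoetherianRing R]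
    {n : ℕ} (W : Submodule R (Fin n → R)) : ∃ (m : ℕ) (A : Matrix (Fin m) (Fin n) R) (d : R),
      W = Submodule.span R (Set.range fun i => A i) ∧ IsGcdOfMaximalMinors A d := by
  obtain ⟨m, A, hA⟩ := Submodule.fg_iff_exists_fin_generating_family.1 (IsNoetherian.noetherian W)
  obtain ⟨d, h1, h2⟩ := exists_finset_gcd Finset.univ
    fun f : Fin n → Fin m => (Matrix.submatrix (Matrix.of A) f id).det
  exact ⟨m, A, d, hA.symm, fun f => h1 f (Finset.mem_univ f), fun e he => h2 e fun f _ => he f⟩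

theorem exists_isDetGcd [IsDomain R] [UniqueFactorizationMonoid R] [IsNoetherianRing R]
    (W : Submodule R (ι → R)) : ∃ d, IsDetGcd W d := by
  have e := Fintype.equivFin ι
  obtain ⟨m, A, d, hW, hd⟩ := exists_isDetGcd_of_fin (W.comap (LinearMap.funLeft R R e))
  have key : ∀ a, DetDvd W a ↔ ∀ f : Fin (Fintype.card ι) → Fin m, a ∣ (A.submatrix f id).det := by
    intro a
    rw [← detDvd_span_range_iff, ← hW]
    refine ⟨fun h => h.comap_equiv e, fun h => ?_⟩
    convert h.comap_equiv e.symm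
    ext w
    simp [Submodule.mem_comap, LinearMap.funLeft, Function.comp_assoc]
  exact ⟨d, (key d).2 hd.1, fun a ha => hd.2 a ((key a).1 ha)⟩

theorem exists_isOrder [IsDomain R] [UniqueFactorizationMonoid R] [IsNoetherianRing R]
    [Module.Finite R M] : ∃ d, IsOrder R M d := by
  obtain ⟨n, v, hv⟩ := Module.Finite.exists_fin (R := R) (M := M)
  obtain ⟨m, A, d, hW, hd⟩ := exists_isDetGcd_of_fin (relModule R v)
  exact ⟨d, m, n, A, ⟨v, hv, fun c => by rw [← mem_relModule, ← hW]⟩, hd⟩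

theorem IsOrder.associated [IsDomain R] {d d' : R} (h : IsOrder R M d) (hd : Associated d d') :
    IsOrder R M d' := by
  obtain ⟨m, n, A, hA, h1, h2⟩ := h
  exact ⟨m, n, A, hA, fun f => hd.symm.dvd.trans (h1 f), fun e he => (h2 e he).trans hd.dvd⟩

end Relations

/-! ### Orders and restriction of scalars -/

section Norm

variable {R S : Type*} [CommRing R] [CommRing S] [UniqueFactorizationMonoid S] [Algebra R S]
  [Algebra.IsIntegral R S] [FaithfulSMul R S]

/-- An ideal without common divisors meets the complement of every principal prime of a subring
over which the ring is integral. -/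
theorem exists_algebraMap_mem_of_isUnit {p : R} (hp : Prime p) {J : Ideal S}
    (hJ : ∀ q, (∀ a ∈ J, q ∣ a) → IsUnit q) : ∃ u, ¬ p ∣ u ∧ algebraMap R S u ∈ J := by
  by_contra! hcon
  have hP : (Ideal.span {p}).IsPrime := (Ideal.span_singleton_prime hp.ne_zero).2 hp
  -- If J meets R only inside (p), lying over gives a prime Q ⊇ J above (p). It contains a prime
  -- factor q of p.
  obtain ⟨Q, hJQ, hQ, hQp⟩ := Ideal.exists_ideal_over_prime_of_isIntegral (Ideal.span {p}) J
    fun u hu => Ideal.mem_span_singleton.2 (not_not.1 fun h => hcon u h hu)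
  have hpQ : algebraMap R S p ∈ Q := by
    rw [← Ideal.mem_comap, hQp]
    exact Ideal.mem_span_singleton_self p
  have hp0 : algebraMap R S p ≠ 0 := by
    simpa using hp.ne_zero
  obtain ⟨f, hf, hprod⟩ := UniqueFactorizationMonoid.exists_prime_factors _ hp0
  have hprodQ : f.prod ∈ Q := Q.mem_of_dvd hprod.symm.dvd hpQ
  obtain ⟨q, hqf, hqQ⟩ := (hQ.multiset_prod_mem_iff_exists_mem f).1 hprodQ
  have hq := hf q hqf
  have hqp : q ∣ algebraMap R S p := (Multiset.dvd_prod hqf).trans hprod.dvd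
  have hqprime : (Ideal.span {q}).IsPrime := (Ideal.span_singleton_prime hq.ne_zero).2 hq
  have hle : Ideal.span {q} ≤ Q := (Ideal.span_singleton_le_iff_mem _).2 hqQ
  -- By incomparability (q) cannot be strictly smaller than Q, since both contract to ideals
  -- containing p. Hence Q = (q), and q is a nonunit dividing all of J.
  rcases hle.lt_or_eq with hlt | heq
  · have := Ideal.IsIntegral.comap_lt_comap (R := R) hlt
    rw [hQp] at this
    refine this.not_ge ((Ideal.span_singleton_le_iff_mem _).2 ?_)
    exact Ideal.mem_comap.2 (Ideal.mem_span_singleton.2 hqp)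
  · exact hq.not_isUnit (hJ q fun a ha => Ideal.mem_span_singleton.1 (heq ▸ hJQ ha))

variable [IsDomain S] [IsNoetherianRing S]

/-- Locally at a principal prime of the subring, ideals are principal. -/
theorem exists_smul_le_span_singleton {p : R} (hp : Prime p) (I : Ideal S) :
    ∃ u, ¬ p ∣ u ∧ ∃ c ∈ I, ∀ a ∈ I, c ∣ algebraMap R S u * a := by
  by_cases hI : I = ⊥
  · exact ⟨1, fun h => hp.not_isUnit (isUnit_of_dvd_one h), 0, I.zero_mem, by simp [hI]⟩
  obtain ⟨s, hs⟩ := IsNoetherian.noetherian I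
  obtain ⟨d, hd, hd'⟩ := exists_finset_gcd s id
  have hdI : ∀ a ∈ I, d ∣ a := by
    have : I ≤ Ideal.span {d} := hs ▸ Submodule.span_le.2
      fun a ha => Ideal.mem_span_singleton.2 (hd a ha)
    exact fun a ha => Ideal.mem_span_singleton.1 (this ha)
  have hsI : ∀ a ∈ s, a ∈ I := fun a ha => hs ▸ Submodule.subset_span ha
  have hd0 : d ≠ 0 := by
    rintro rfl
    exact hI ((Submodule.eq_bot_iff _).2 fun a ha => zero_dvd_iff.1 (hdI a ha))
  -- With d the gcd of I, one has I = dJ, and J has no nontrivial common divisor.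
  let J : Ideal S := Submodule.comap (LinearMap.mulLeft S d) I
  obtain ⟨u, hu, huJ⟩ := exists_algebraMap_mem_of_isUnit (R := R) hp (J := J) fun q hq => by
    have : d * q ∣ d := hd' _ fun a ha => by
      obtain ⟨b, rfl⟩ := hdI a (hsI a ha)
      exact mul_dvd_mul_left d (hq b (hsI _ ha))
    rw [← mul_one d, mul_assoc, one_mul, mul_dvd_mul_iff_left hd0] at this
    exact isUnit_of_dvd_one this
  refine ⟨u, hu, d * algebraMap R S u, huJ, fun a ha => ?_⟩
  rw [mul_comm]
  exact mul_dvd_mul_left _ (hdI a ha)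

/-- Locally at a principal prime of the subring, submodules of `S ^ n` are generated by
`n` elements. -/
theorem exists_smul_mem_span_of_fin {p : R} (hp : Prime p) {n : ℕ} (W : Submodule S (Fin n → S)) :
    ∃ u, ¬ p ∣ u ∧ ∃ C : Matrix (Fin n) (Fin n) S, (∀ i, C i ∈ W) ∧
      ∀ w ∈ W, ∃ a : Fin n → S, algebraMap R S u • w = Matrix.vecMul a C := by
  induction n with
  | zero => exact ⟨1, fun h => hp.not_isUnit (isUnit_of_dvd_one h), 0, fun i => i.elim0,
      fun w _ => ⟨0, Subsingleton.elim _ _⟩⟩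
  | succ n ih =>
    -- As for submodules of free modules over a principal ideal domain: c generates the first
    -- coordinates up to u, and subtracting a multiple of c leaves a vector with first coordinate 0.
    obtain ⟨u, hu, c, hc, hcI⟩ := exists_smul_le_span_singleton (R := R) hp
      (W.map (LinearMap.proj 0 : (Fin (n + 1) → S) →ₗ[S] S))
    obtain ⟨c, hcW, rfl⟩ := hc
    let ins : (Fin n → S) →ₗ[S] (Fin (n + 1) → S) :=
      { toFun := fun x => (Fin.cons 0 x : Fin (n + 1) → S)
        map_add' := fun x y => by ext i; refine Fin.cases ?_ (fun j => ?_) i <;> simp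
        map_smul' := fun x y => by ext i; refine Fin.cases ?_ (fun j => ?_) i <;> simp }
    obtain ⟨u', hu', C, hC, hCW⟩ := ih (W.comap ins)
    refine ⟨u * u', fun h => (hp.dvd_or_dvd h).elim hu hu', Fin.cons c fun i => ins (C i),
      fun i => ?_, fun w hw => ?_⟩
    · refine Fin.cases ?_ (fun j => ?_) i
      · exact hcW
      · exact hC j
    · obtain ⟨a, ha⟩ := hcI (w 0) ⟨w, hw, rfl⟩
      have ha : algebraMap R S u * w 0 = c 0 * a := ha
      let w' := algebraMap R S u • w - a • c
      have hw' : w' ∈ W := W.sub_mem (W.smul_mem _ hw) (W.smul_mem _ hcW)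
      have hins : ins (Fin.tail w') = w' := by
        ext i
        refine Fin.cases ?_ (fun j => rfl) i
        change 0 = algebraMap R S u * w 0 - a * c 0
        rw [ha, mul_comm, sub_self]
      obtain ⟨b, hb⟩ := hCW (Fin.tail w') (by rwa [Submodule.mem_comap, hins])
      refine ⟨Fin.cons (algebraMap R S u' * a) b, ?_⟩
      have h2 : algebraMap R S u' • w' = ins (Matrix.vecMul b C) := by
        rw [← hb, map_smul, hins]
      have h3 : Matrix.vecMul (Fin.cons (algebraMap R S u' * a) b : Fin (n + 1) → S)
          (Fin.cons c fun i => ins (C i) : Fin (n + 1) → Fin (n + 1) → S) =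
          (algebraMap R S u' * a) • c + ins (Matrix.vecMul b C) := by
        refine (Matrix.vecMul_eq_sum _ _).trans ?_
        rw [Fin.sum_univ_succ, Matrix.vecMul_eq_sum, map_sum]
        simp only [Fin.cons_zero, Fin.cons_succ, map_smul]
      refine Eq.trans ?_ h3.symm
      rw [← h2, smul_sub, mul_smul, map_mul, mul_comm (algebraMap R S u), mul_smul]
      exact (add_sub_cancel _ _).symm

theorem exists_smul_mem_span {p : R} (hp : Prime p) {ι : Type*} [Fintype ι]
    (W : Submodule S (ι → S)) :
    ∃ u, ¬ p ∣ u ∧ ∃ C : Matrix ι ι S, (∀ i, C i ∈ W) ∧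
      ∀ w ∈ W, ∃ a : ι → S, algebraMap R S u • w = Matrix.vecMul a C := by
  have e := Fintype.equivFin ι
  obtain ⟨u, hu, C, hC, hCW⟩ := exists_smul_mem_span_of_fin hp
    (W.comap (LinearMap.funLeft S S e))
  refine ⟨u, hu, C.submatrix e e, fun i => hC (e i), fun w hw => ?_⟩
  have hw' : w ∘ e.symm ∈ W.comap (LinearMap.funLeft S S e) := by
    rw [Submodule.mem_comap]
    convert hw
    ext i
    simp [LinearMap.funLeft_apply]
  obtain ⟨a, ha⟩ := hCW _ hw'
  refine ⟨a ∘ e, ?_⟩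
  ext i
  have := congrFun ha (e i)
  simp only [Pi.smul_apply, Function.comp_apply, e.symm_apply_apply] at this ⊢
  rw [this, Matrix.vecMul, Matrix.vecMul, dotProduct, dotProduct]
  exact (e.sum_comp fun k => a k * C k (e i)).symm

end Norm

/-! ### Coordinates over the base ring and norms of determinants -/

section Restrict

variable {R S : Type*} [CommRing R] [CommRing S] [Algebra R S] {ι κ : Type*} [Fintype κ]
  (b : Module.Basis κ R S)

/-- The vector over `S` with the given coordinates over `R`. -/
def ofCoords (ι : Type*) : (ι × κ → R) →ₗ[R] (ι → S) :=
  LinearMap.pi fun i => Fintype.linearCombination R b ∘ₗ LinearMap.funLeft R R fun k => (i, k)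

theorem ofCoords_apply (c : ι × κ → R) (i : ι) : ofCoords b ι c i = ∑ k, c (i, k) • b k := by
  simp [ofCoords, Fintype.linearCombination_apply, LinearMap.funLeft_apply]

theorem ofCoords_injective : Function.Injective (ofCoords b ι) := by
  intro c c' h
  ext ⟨i, k⟩
  have := congrArg (fun x => b.repr x k) (congrFun h i)
  simpa only [ofCoords_apply, b.repr_sum_self] using this

theorem ofCoords_repr (w : ι → S) : ofCoords b ι (fun x => b.repr (w x.1) x.2) = w := by
  ext i
  rw [ofCoords_apply]
  exact b.sum_repr (w i)

/-- The submodule `W` in coordinates over `R`. -/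
def restrictCoords (W : Submodule S (ι → S)) : Submodule R (ι × κ → R) :=
  (W.restrictScalars R).comap (ofCoords b ι)

/-- The matrix over `R` whose rows are the coordinates of the multiples of the rows of `C`
by the basis. -/
def restrictMatrix (C : Matrix ι ι S) : Matrix (ι × κ) (ι × κ) R :=
  fun x y => b.repr (b x.2 * C x.1 y.1) y.2

theorem ofCoords_restrictMatrix (C : Matrix ι ι S) (x : ι × κ) :
    ofCoords b ι (restrictMatrix b C x) = b x.2 • C x.1 :=
  ofCoords_repr b (b x.2 • C x.1)

/-- The blocks are matrices of multiplications by elements of S, so they commute and the determinant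
of determinants formula applies. -/
theorem det_restrictMatrix [Fintype ι] [DecidableEq ι] [DecidableEq κ] (C : Matrix ι ι S) :
    (restrictMatrix b C).det = Algebra.norm R C.det := by
  rw [Algebra.norm_eq_matrix_det b, ← Matrix.det_transpose C, ← AlgHom.coe_toRingHom,
    Matrix.det_det, ← Matrix.det_transpose]
  congr 1
  ext ⟨i, k⟩ ⟨j, l⟩
  simp [restrictMatrix, Algebra.leftMulMatrix_eq_repr_mul, mul_comm]

theorem exists_mul_restrictMatrix [Fintype ι] {W : Submodule S (ι → S)} {C : Matrix ι ι S} {u : R}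
    (hC : ∀ w ∈ W, ∃ a : ι → S, algebraMap R S u • w = Matrix.vecMul a C)
    (E : Matrix (ι × κ) (ι × κ) R) (hE : ∀ x, E x ∈ restrictCoords b W) :
    ∃ A, u • E = A * restrictMatrix b C := by
  choose a ha using fun x => hC _ (hE x)
  let A : Matrix (ι × κ) (ι × κ) R := fun x y => b.repr (a x y.1) y.2
  refine ⟨A, ?_⟩
  funext x
  apply ofCoords_injective b
  have h1 : (A * restrictMatrix b C) x = ∑ y : ι × κ, b.repr (a x y.1) y.2 • restrictMatrix b C y := by
    ext z
    rw [Matrix.mul_apply, Finset.sum_apply]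
    rfl
  have h2 : (u • E) x = u • E x := rfl
  rw [h1, h2, map_smul, ← algebraMap_smul S u, ha, Matrix.vecMul_eq_sum, map_sum,
    Fintype.sum_prod_type]
  refine Finset.sum_congr rfl fun i _ => ?_
  conv_lhs => rw [← b.sum_repr (a x i), Finset.sum_smul]
  refine Finset.sum_congr rfl fun k _ => ?_
  rw [map_smul, ofCoords_restrictMatrix, smul_assoc]

/-- Divisibility is local at principal primes. The prime p₀ keeps the hypothesis from being vacuous
when a = 0. -/
theorem dvd_of_forall_prime {R : Type*} [CommRing R] [IsDomain R] [UniqueFactorizationMonoid R]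
    {p₀ : R} (hp₀ : Prime p₀) {a b : R} (h : ∀ p, Prime p → ∃ u, ¬ p ∣ u ∧ a ∣ u * b) : a ∣ b := by
  by_cases ha : a = 0
  · obtain ⟨u, hu, hab⟩ := h p₀ hp₀
    rw [ha, zero_dvd_iff, mul_eq_zero] at hab
    rw [ha, hab.resolve_left fun h0 => hu (h0 ▸ dvd_zero _)]
  · obtain ⟨b', a', c, hcop, hb, ha'⟩ := UniqueFactorizationMonoid.exists_reduced_factors' b a ha
    have hc : c ≠ 0 := by
      rintro rfl
      simp [← ha'] at ha
    by_cases hu : IsUnit a'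
    · rw [← hb, ← ha', hu.mul_right_dvd]
      exact dvd_mul_right _ _
    · obtain ⟨p, hp, hpa⟩ := WfDvdMonoid.exists_irreducible_factor hu (by
        rintro rfl
        simp [← ha'] at ha)
      obtain ⟨u, hu, hab⟩ := h p hp.prime
      rw [← hb, ← ha', mul_left_comm, mul_dvd_mul_iff_left hc] at hab
      have h1 : a' ∣ u := hcop.symm.dvd_of_dvd_mul_right hab
      exact absurd (hpa.trans h1) hu

/-- The order of the restriction of scalars is the norm of the order. -/
theorem IsDetGcd.associated_norm [IsDomain R] [UniqueFactorizationMonoid R] {p₀ : R} (hp₀ : Prime p₀)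
    [UniqueFactorizationMonoid S] [IsDomain S] [IsNoetherianRing S] [FaithfulSMul R S]
    [Fintype ι] [DecidableEq ι] [DecidableEq κ] {W : Submodule S (ι → S)} {d : S} {D : R}
    (hd : IsDetGcd W d) (hD : IsDetGcd (restrictCoords b W) D) :
    Associated D (Algebra.norm R d) := by
  have := Module.Finite.of_basis b
  -- Up to a factor u prime to p, the rows of one square matrix C generate W. Both D and the norm of
  -- d are compared with the norm of det C; the exponent of u is the size of the matrix over R.
  have key : ∀ p : R, Prime p → ∃ u, ¬ p ∣ u ∧ D ∣ u * Algebra.norm R d ∧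
      Algebra.norm R d ∣ u * D := by
    intro p hp
    obtain ⟨u, hu, C, hC, hCW⟩ := exists_smul_mem_span (R := R) hp W
    have hu0 : u ≠ 0 := fun h => hu (h ▸ dvd_zero _)
    have hpow : ∀ n, ¬ p ∣ u ^ n := fun n h => hu (hp.dvd_of_dvd_pow h)
    refine ⟨u ^ Fintype.card (ι × κ), hpow _, ?_, ?_⟩
    · have h1 : C.det ∣ algebraMap R S u ^ Fintype.card ι * d := by
        refine hd.dvd_mul (pow_ne_zero _ (by simpa using hu0)) fun w hw => ?_
        choose a ha using fun i => hCW _ (hw i)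
        have : algebraMap R S u • w = Matrix.of a * C := by
          funext i
          exact (ha i).trans (by ext j; simp [Matrix.mul_apply, Matrix.vecMul, dotProduct])
        rw [← Matrix.det_smul, this, Matrix.det_mul]
        exact dvd_mul_left _ _
      have h2 : D ∣ Algebra.norm R C.det := by
        rw [← det_restrictMatrix b]
        refine hD.1 _ fun x => ?_
        change ofCoords b ι _ ∈ W
        rw [ofCoords_restrictMatrix]
        exact W.smul_mem _ (hC _)
      refine h2.trans ((map_dvd _ h1).trans ?_)
      rw [map_mul, map_pow, Algebra.norm_algebraMap_of_basis b, Fintype.card_prod,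
        mul_comm (Fintype.card ι), pow_mul]
    · refine (map_dvd (Algebra.norm R) (hd.1 C hC)).trans
        (hD.dvd_mul (pow_ne_zero _ hu0) fun E hE => ?_)
      obtain ⟨A, hA⟩ := exists_mul_restrictMatrix b hCW E hE
      rw [← Matrix.det_smul, hA, Matrix.det_mul, det_restrictMatrix]
      exact dvd_mul_left _ _
  exact associated_of_dvd_dvd
    (dvd_of_forall_prime hp₀ fun p hp => let ⟨u, h1, h2, _⟩ := key p hp; ⟨u, h1, h2⟩)
    (dvd_of_forall_prime hp₀ fun p hp => let ⟨u, h1, _, h2⟩ := key p hp; ⟨u, h1, h2⟩)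

end Restrict

/-! ### Laurent polynomials in a root of the variable -/

section Laurent

open LaurentPolynomial

instance : UniqueFactorizationMonoid ℤ[T;T⁻¹] :=
  UniqueFactorizationMonoid.of_isLocalization
    (Submonoid.powers (Polynomial.X : Polynomial ℤ)) ℤ[T;T⁻¹]

instance : IsNoetherianRing ℤ[T;T⁻¹] :=
  IsLocalization.isNoetherianRing (Submonoid.powers (Polynomial.X : Polynomial ℤ)) _ inferInstance

theorem T_one_sub_one_ne_zero : (T 1 - 1 : ℤ[T;T⁻¹]) ≠ 0 := by
  rw [← T_zero, sub_ne_zero]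
  intro h
  have := congrArg (fun f : ℤ[T;T⁻¹] => f.coeff 1) h
  simp only [T_apply] at this
  simp at this

theorem exists_prime_laurent : ∃ p : ℤ[T;T⁻¹], Prime p := by
  have h : ¬ IsUnit (T 1 - 1 : ℤ[T;T⁻¹]) := fun h => by
    have := h.map (LaurentPolynomial.eval₂ (RingHom.id ℤ) 1)
    simp at this
  obtain ⟨p, hp, -⟩ := WfDvdMonoid.exists_irreducible_factor h T_one_sub_one_ne_zero
  exact ⟨p, hp.prime⟩

theorem coeff_C_mul_T {A : Type*} [CommRing A] (a : A) (n m : ℤ) :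
    (C a * T n : A[T;T⁻¹]).coeff m = if n = m then a else 0 := by
  rw [← single_eq_C_mul_T]
  exact Finsupp.single_apply

/-- The ring of Laurent polynomials in an `r`-th root of the variable `s`. -/
def LaurentRoot (_r : ℕ) : Type := ℤ[T;T⁻¹]

variable (r : ℕ)

instance : CommRing (LaurentRoot r) := inferInstanceAs (CommRing ℤ[T;T⁻¹])
instance : IsDomain (LaurentRoot r) := inferInstanceAs (IsDomain ℤ[T;T⁻¹])
instance : IsNoetherianRing (LaurentRoot r) := inferInstanceAs (IsNoetherianRing ℤ[T;T⁻¹])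
instance : UniqueFactorizationMonoid (LaurentRoot r) :=
  inferInstanceAs (UniqueFactorizationMonoid ℤ[T;T⁻¹])

/-- The substitution `s ↦ t ^ r`. -/
def substPow : ℤ[T;T⁻¹] →+* ℤ[T;T⁻¹] :=
  AddMonoidAlgebra.mapDomainRingHom ℤ (AddMonoidHom.mulLeft (r : ℤ))

theorem substPow_C_mul_T (a n : ℤ) : substPow r (C a * T n) = C a * T (r * n) := by
  rw [← single_eq_C_mul_T, ← single_eq_C_mul_T]
  exact AddMonoidAlgebra.mapDomain_single

theorem substPow_T (n : ℤ) : substPow r (T n) = T (r * n) := by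
  simpa using substPow_C_mul_T r 1 n

instance : Algebra ℤ[T;T⁻¹] (LaurentRoot r) :=
  RingHom.toAlgebra (S := LaurentRoot r) (substPow r)

theorem laurentRoot_algebraMap (f : ℤ[T;T⁻¹]) :
    algebraMap ℤ[T;T⁻¹] (LaurentRoot r) f = substPow r f := rfl

/-- Exponents separate by their residue modulo r; this gives the independence of 1, t, …, t^(r-1).
-/
theorem coeff_substPow_mul_T (f : ℤ[T;T⁻¹]) (i j : Fin r) (m : ℤ) :
    (substPow r f * T (j : ℤ)).coeff (r * m + i) = if i = j then f.coeff m else 0 := by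
  induction f using LaurentPolynomial.induction_on' with
  | add p q hp hq =>
    rw [RingHom.map_add, add_mul, AddMonoidAlgebra.coeff_add, Finsupp.add_apply, hp, hq,
      AddMonoidAlgebra.coeff_add, Finsupp.add_apply]
    split <;> simp
  | C_mul_T n a =>
    rw [substPow_C_mul_T, mul_T_assoc, coeff_C_mul_T, coeff_C_mul_T]
    have hi := i.2
    have hj := j.2
    by_cases hij : i = j
    · subst hij
      have : (r : ℤ) ≠ 0 := by omega
      simp only [add_left_inj, mul_right_inj' this, if_true]
    · rw [if_neg hij, if_neg]
      intro h
      apply hij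
      ext
      have h1 := congrArg (· % (r : ℤ)) h
      simp only [Int.mul_add_emod_self_left] at h1
      rw [Int.emod_eq_of_lt (by omega) (by omega), Int.emod_eq_of_lt (by omega) (by omega)] at h1
      exact_mod_cast h1.symm

variable [NeZero r]

/-- The basis `1, t, …, t ^ (r - 1)`. -/
def laurentRootBasis : Module.Basis (Fin r) ℤ[T;T⁻¹] (LaurentRoot r) :=
  Module.Basis.mk (v := fun i : Fin r => (show LaurentRoot r from T (i : ℤ)))
    (by
      rw [Fintype.linearIndependent_iff]
      intro g hg i
      ext m
      have h1 : (∑ j : Fin r, substPow r (g j) * T (j : ℤ) : ℤ[T;T⁻¹]) = 0 := hg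
      have := congrArg (fun f : ℤ[T;T⁻¹] => f.coeff (r * m + i)) h1
      simpa [AddMonoidAlgebra.coeff_sum, Finsupp.finsetSum_apply, coeff_substPow_mul_T] using this)
    (by
      rintro f -
      change (f : ℤ[T;T⁻¹]) ∈ (Submodule.span ℤ[T;T⁻¹] (Set.range
        fun i : Fin r => (show LaurentRoot r from T (i : ℤ))) : Set (LaurentRoot r))
      induction f using LaurentPolynomial.induction_on' with
      | add p q hp hq => exact Submodule.add_mem _ hp hq
      | C_mul_T n a =>
        have hr : (r : ℤ) ≠ 0 := by exact_mod_cast NeZero.ne r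
        have h0 := Int.emod_nonneg n hr
        have h1 := Int.emod_lt_of_pos n (by omega : (0 : ℤ) < r)
        let i : Fin r := ⟨(n % r).toNat, by omega⟩
        have hi : (i : ℤ) = n % r := Int.toNat_of_nonneg h0
        have : (C a * T n : ℤ[T;T⁻¹]) = substPow r (C a * T (n / r)) * T (i : ℤ) := by
          rw [substPow_C_mul_T, mul_T_assoc, hi, Int.mul_ediv_add_emod]
        rw [this]
        exact Submodule.smul_mem _ _ (Submodule.subset_span ⟨i, rfl⟩))

/-- The power basis `1, t, …, t ^ (r - 1)`. -/
def laurentRootPowerBasis : PowerBasis ℤ[T;T⁻¹] (LaurentRoot r) where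
  gen := (show LaurentRoot r from T 1)
  dim := r
  basis := laurentRootBasis r
  basis_eq_pow i := by
    rw [laurentRootBasis, Module.Basis.mk_apply]
    exact (by rw [T_pow, mul_one] : (T (i : ℤ) : ℤ[T;T⁻¹]) = T 1 ^ (i : ℕ))

instance : Module.Finite ℤ[T;T⁻¹] (LaurentRoot r) := Module.Finite.of_basis (laurentRootBasis r)

instance : Module.Free ℤ[T;T⁻¹] (LaurentRoot r) := Module.Free.of_basis (laurentRootBasis r)

open Polynomial in
theorem minpoly_laurentRoot :
    minpoly ℤ[T;T⁻¹] (laurentRootPowerBasis r).gen =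
      (X ^ r - Polynomial.C (T 1) : Polynomial ℤ[T;T⁻¹]) := by
  symm
  refine minpoly.unique' _ _ (monic_X_pow_sub_C _ (NeZero.ne r)) ?_ fun q hq => ?_
  · rw [map_sub, aeval_X_pow, aeval_C, sub_eq_zero]
    refine (T_pow 1 r).trans ?_
    rw [laurentRoot_algebraMap, substPow_T]
  · refine or_iff_not_imp_left.2 fun h0 hroot => ?_
    have := (laurentRootPowerBasis r).dim_le_degree_of_root h0 hroot
    rw [degree_X_pow_sub_C (NeZero.pos r)] at hq
    exact hq.not_ge this

/-- The norm of the Laurent polynomial of `f` is `±f⁽ʳ⁾`, and the latter has integral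
coefficients. -/
theorem exists_map_eq_powRoots (f : Polynomial ℤ) :
    ∃ F : Polynomial ℤ, F.map (Int.castRingHom ℂ) = powRoots r (f.map (Int.castRingHom ℂ)) ∧
      Associated (Algebra.norm ℤ[T;T⁻¹] (show LaurentRoot r from Polynomial.toLaurent f))
        (Polynomial.toLaurent F) := by
  let pb := laurentRootPowerBasis r
  let Φ : ℤ[T;T⁻¹] →+* ℂ[T;T⁻¹] := AddMonoidAlgebra.mapRingHom ℤ (Int.castRingHom ℂ)
  let ψ : LaurentRoot r →+* Matrix (Fin r) (Fin r) ℂ[T;T⁻¹] :=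
    Φ.mapMatrix.comp (Algebra.leftMulMatrix pb.basis).toRingHom
  let M : Matrix (Fin r) (Fin r) ℂ[T;T⁻¹] := ψ pb.gen
  -- M is multiplication by t over ℂ[s^±1], and δ g = det g(M) extends the norm multiplicatively to
  -- complex polynomials, where g splits.
  let δ : Polynomial ℂ →* ℂ[T;T⁻¹] := (Matrix.detMonoidHom).comp (Polynomial.aeval M).toRingHom.toMonoidHom
  have hT : Φ (T 1) = T 1 := by
    change AddMonoidAlgebra.mapRingHom ℤ (Int.castRingHom ℂ) (AddMonoidAlgebra.single 1 1) = _
    rw [AddMonoidAlgebra.mapRingHom_single, map_one]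
    rfl
  have hM : M.charpoly = Polynomial.X ^ r - Polynomial.C (T 1) := by
    have h1 := charpoly_leftMulMatrix pb
    rw [minpoly_laurentRoot] at h1
    have h2 := Matrix.charpoly_map (Algebra.leftMulMatrix pb.basis pb.gen) Φ
    change ((Algebra.leftMulMatrix pb.basis pb.gen).map Φ).charpoly = _
    rw [h2, h1]
    simp [hT]
  have hC : ∀ c : ℂ, δ (Polynomial.C c) = Polynomial.toLaurent (Polynomial.C (c ^ r)) := by
    intro c
    change (Polynomial.aeval M (Polynomial.C c)).det = _
    rw [Polynomial.aeval_C, Matrix.algebraMap_eq_diagonal, Matrix.det_diagonal]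
    rw [Polynomial.toLaurent_C, map_pow]
    refine (Finset.prod_const (C c : ℂ[T;T⁻¹])).trans ?_
    rw [Finset.card_univ, Fintype.card_fin]
  -- det(M - ξ) = (-1)^r (ξ^r - s), from the characteristic polynomial of M evaluated at ξ.
  have hX : ∀ ξ : ℂ, δ (Polynomial.X - Polynomial.C ξ) =
      (-1) ^ (r + 1) * Polynomial.toLaurent (Polynomial.X - Polynomial.C (ξ ^ r)) := by
    intro ξ
    change (Polynomial.aeval M (Polynomial.X - Polynomial.C ξ)).det = _
    have h1 := Matrix.eval_charpoly M (C ξ)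
    rw [hM] at h1
    have h2 : Matrix.scalar (Fin r) (C ξ) - M =
        -Polynomial.aeval M (Polynomial.X - Polynomial.C ξ) := by
      rw [map_sub, Polynomial.aeval_X, Polynomial.aeval_C, neg_sub]
      rfl
    rw [h2, Matrix.det_neg, Fintype.card_fin] at h1
    have h3 : ((-1) ^ r * (-1) ^ r : ℂ[T;T⁻¹]) = 1 := by rw [← mul_pow]; simp
    have h4 : Polynomial.toLaurent (Polynomial.X - Polynomial.C (ξ ^ r)) =
        -Polynomial.eval (C ξ) (Polynomial.X ^ r - Polynomial.C (T 1) : Polynomial ℂ[T;T⁻¹]) := by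
      rw [map_sub, Polynomial.toLaurent_X, Polynomial.toLaurent_C, Polynomial.eval_sub,
        Polynomial.eval_pow, Polynomial.eval_X, Polynomial.eval_C, map_pow, neg_sub]
    rw [h4, h1, pow_succ]
    linear_combination -(Polynomial.aeval M (Polynomial.X - Polynomial.C ξ)).det * h3
  have hδ : ∀ g : Polynomial ℂ, δ g =
      ((-1) ^ (r + 1)) ^ (Multiset.card g.roots) * Polynomial.toLaurent (powRoots r g) := by
    intro g
    conv_lhs => rw [(IsAlgClosed.splits g).eq_prod_roots]
    rw [map_mul, hC, map_multiset_prod, Multiset.map_map, powRoots, map_mul, map_multiset_prod,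
      Multiset.map_map, mul_left_comm]
    congr 1
    rw [← Multiset.prod_replicate, ← Multiset.map_const', ← Multiset.prod_map_mul]
    congr 1
    exact Multiset.map_congr rfl fun ξ _ => hX ξ
  have hN : Φ (Algebra.norm ℤ[T;T⁻¹] (show LaurentRoot r from Polynomial.toLaurent f)) =
      δ (f.map (Int.castRingHom ℂ)) := by
    rw [Algebra.norm_eq_matrix_det pb.basis, RingHom.map_det]
    have h1 : (show LaurentRoot r from Polynomial.toLaurent f) =
        f.eval₂ (Int.castRingHom _) pb.gen := by
      change Polynomial.toLaurent f = f.eval₂ (Int.castRingHom ℤ[T;T⁻¹]) (T 1)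
      rw [← Polynomial.toLaurent_X, RingHom.ext_int (Int.castRingHom _) (Polynomial.toLaurent.comp Polynomial.C),
        ← Polynomial.hom_eval₂ f Polynomial.C Polynomial.toLaurent Polynomial.X, Polynomial.eval₂_C_X]
    change (ψ _).det = (Polynomial.aeval M _).det
    rw [h1, Polynomial.hom_eval₂, Polynomial.aeval_def, Polynomial.eval₂_map]
    congr 2
    exact RingHom.ext_int _ _
  set n := Algebra.norm ℤ[T;T⁻¹] (show LaurentRoot r from Polynomial.toLaurent f)
  set g := powRoots r (f.map (Int.castRingHom ℂ))
  set m := Multiset.card (f.map (Int.castRingHom ℂ)).roots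
  have he : (((-1) ^ (r + 1)) ^ m * ((-1) ^ (r + 1)) ^ m : ℤ) = 1 := by
    rw [← mul_pow, ← mul_pow]
    simp
  set e : ℤ := ((-1) ^ (r + 1)) ^ m with hedef
  have heC : (e : ℂ) * e = 1 := by exact_mod_cast he
  have hΦ : ∀ q : Polynomial ℤ, Φ (Polynomial.toLaurent q) =
      Polynomial.toLaurent (q.map (Int.castRingHom ℂ)) := by
    intro q
    have : Φ.comp Polynomial.toLaurent =
        Polynomial.toLaurent.comp (Polynomial.mapRingHom (Int.castRingHom ℂ)) := by
      refine Polynomial.ringHom_ext' (RingHom.ext_int _ _) ?_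
      simpa using hT
    exact congrArg (· q) this
  obtain ⟨k, n', hn'⟩ := exists_T_pow n
  have hmap : n'.map (Int.castRingHom ℂ) = Polynomial.X ^ k * (Polynomial.C (e : ℂ) * g) := by
    apply Polynomial.toLaurent_injective
    have h1 : Φ (T k) = T k := by
      rw [← Polynomial.toLaurent_X_pow, hΦ, Polynomial.map_pow, Polynomial.map_X,
        Polynomial.toLaurent_X_pow]
    rw [← hΦ, hn', map_mul, hN, hδ, h1, map_mul, map_mul, Polynomial.toLaurent_X_pow,
      Polynomial.toLaurent_C, mul_comm]
    congr 2
    simp [hedef, m]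
  -- The low coefficients vanish over ℂ, hence over ℤ; removing X^k leaves an integral polynomial
  -- equal to ±f^(r).
  obtain ⟨F, rfl⟩ : Polynomial.X ^ k ∣ n' := by
    rw [Polynomial.X_pow_dvd_iff]
    intro d hd
    have := (Polynomial.X_pow_dvd_iff.1 (Dvd.intro _ hmap.symm)) d hd
    simpa using this
  rw [Polynomial.map_mul, Polynomial.map_pow, Polynomial.map_X] at hmap
  have hF := mul_left_cancel₀ (pow_ne_zero k Polynomial.X_ne_zero) hmap
  refine ⟨Polynomial.C e * F, ?_, ?_⟩
  · rw [Polynomial.map_mul, hF, Polynomial.map_C, ← mul_assoc, ← map_mul]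
    simp [heC]
  · have hu : IsUnit (Polynomial.toLaurent (Polynomial.C e)) :=
      ((IsUnit.of_mul_eq_one _ he).map Polynomial.C).map Polynomial.toLaurent
    have h1 : Associated n (Polynomial.toLaurent F) := by
      rw [map_mul, Polynomial.toLaurent_X_pow] at hn'
      exact (associated_mul_unit_right n _ (isUnit_T k)).trans
        (hn' ▸ associated_unit_mul_left _ _ (isUnit_T k))
    rw [map_mul]
    exact h1.trans (associated_unit_mul_right _ _ hu)

end Laurent

/-! ### The order of an extension by a trivial module -/

section OrderExtension

variable {R S : Type*} [CommRing R] [CommRing S] [Algebra R S] {κ κ' : Type*} [Fintype κ]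
  [Fintype κ'] (b : Module.Basis κ' R S) {B H : Type*} [AddCommGroup B] [Module R B]
  [AddCommGroup H] [Module S H] {θ : H →+ B} {w : κ → B}

/-- The elements `θ (bₖ vᵢ)`. -/
def restrictFamily (θ : H →+ B) {n : ℕ} (v : Fin n → H) (x : Fin n × κ') : B :=
  θ (b x.2 • v x.1)

variable {n : ℕ} {v : Fin n → H}

theorem sum_smul_restrictFamily (hθ : ∀ (a : R) h, θ (algebraMap R S a • h) = a • θ h)
    (c : Fin n × κ' → R) :
    ∑ x, c x • restrictFamily b θ v x = θ (∑ i, ofCoords b (Fin n) c i • v i) := by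
  rw [Fintype.sum_prod_type, map_sum]
  refine Finset.sum_congr rfl fun i _ => ?_
  rw [ofCoords_apply, Finset.sum_smul, map_sum]
  refine Finset.sum_congr rfl fun k _ => ?_
  rw [Algebra.smul_def, mul_smul, hθ, restrictFamily]

theorem relModule_restrictFamily (hinj : Function.Injective θ)
    (hθ : ∀ (a : R) h, θ (algebraMap R S a • h) = a • θ h) :
    relModule R (restrictFamily b θ v) = restrictCoords b (relModule S v) := by
  ext c
  rw [mem_relModule, sum_smul_restrictFamily b hθ, map_eq_zero_iff θ hinj]
  exact mem_relModule.symm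

theorem exists_eq_sum_restrictFamily (hθ : ∀ (a : R) h, θ (algebraMap R S a • h) = a • θ h)
    (hv : Submodule.span S (Set.range v) = ⊤) (h : H) :
    ∃ c : Fin n × κ' → R, θ h = ∑ x, c x • restrictFamily b θ v x := by
  obtain ⟨a, rfl⟩ := (Submodule.mem_span_range_iff_exists_fun S).1
    (hv ▸ Submodule.mem_top : h ∈ Submodule.span S (Set.range v))
  refine ⟨fun x => b.repr (a x.1) x.2, ?_⟩
  rw [sum_smul_restrictFamily b hθ, ofCoords_repr]

theorem span_sumElim_restrictFamily (hθ : ∀ (a : R) h, θ (algebraMap R S a • h) = a • θ h)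
    (h2 : ∀ y, ∃ c : κ → R, y - ∑ k, c k • w k ∈ θ.range)
    (hv : Submodule.span S (Set.range v) = ⊤) :
    Submodule.span R (Set.range (Sum.elim w (restrictFamily b θ v))) = ⊤ := by
  rw [eq_top_iff]
  rintro y -
  obtain ⟨c, h, hc⟩ := h2 y
  obtain ⟨a, ha⟩ := exists_eq_sum_restrictFamily b hθ hv h
  refine (Submodule.mem_span_range_iff_exists_fun R).2 ⟨Sum.elim c a, ?_⟩
  rw [Fintype.sum_sum_type]
  simp only [Sum.elim_inl, Sum.elim_inr]
  rw [← ha, hc, add_sub_cancel]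

include b in
theorem finite_of_extension (hθ : ∀ (a : R) h, θ (algebraMap R S a • h) = a • θ h)
    (h2 : ∀ y, ∃ c : κ → R, y - ∑ k, c k • w k ∈ θ.range) [Module.Finite S H] :
    Module.Finite R B := by
  obtain ⟨n, v, hv⟩ := Module.Finite.exists_fin (R := S) (M := H)
  have := span_sumElim_restrictFamily b hθ h2 hv
  exact ⟨this ▸ Submodule.fg_span (Set.finite_range _)⟩

include b in
/-- If `B` is an extension of `(R ⧸ p) ^ κ` by the `S`-module `H`, its order over `R` is
`p ^ κ` times the norm of the order of `H`. -/
theorem IsOrder.associated_of_extension [IsDomain R] [UniqueFactorizationMonoid R]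
    [IsNoetherianRing R] [IsDomain S] [UniqueFactorizationMonoid S] [IsNoetherianRing S]
    [FaithfulSMul R S] {p₀ : R} (hp₀ : Prime p₀) (hinj : Function.Injective θ)
    (hθ : ∀ (a : R) h, θ (algebraMap R S a • h) = a • θ h) {p : R} (hp : p ≠ 0)
    (h1 : ∀ k, p • w k ∈ θ.range) (h2 : ∀ y, ∃ c : κ → R, y - ∑ k, c k • w k ∈ θ.range)
    (h3 : ∀ c : κ → R, ∑ k, c k • w k ∈ θ.range → ∀ k, p ∣ c k) {D : R} {Δ : S}
    (hD : IsOrder R B D) (hΔ : IsOrder S H Δ) :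
    Associated D (p ^ Fintype.card κ * Algebra.norm R Δ) := by
  classical
  obtain ⟨m, n, A, ⟨v, hv, hA⟩, hd⟩ := id hΔ
  have hΔ' := hΔ.isDetGcd hv
  -- D' is the order of H over R: its relation module for the generators bₖ vᵢ is that over S
  -- written in coordinates.
  obtain ⟨D', hD'⟩ := exists_isDetGcd (restrictCoords b (relModule S v))
  have hass := hΔ'.associated_norm b hp₀ hD'
  rw [← relModule_restrictFamily b hinj hθ] at hD'
  choose h hh using h1
  choose Q hQ using fun k => exists_eq_sum_restrictFamily b hθ hv (h k)
  have key := hD'.relModule_sumElim (w := w) hp (Q := Q) (fun k => by rw [← hQ, hh])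
    fun c hc k => h3 (fun k => c (Sum.inl k)) (by
      rw [mem_relModule, Fintype.sum_sum_type] at hc
      have hc := eq_neg_of_add_eq_zero_left hc
      simp only [Sum.elim_inl, Sum.elim_inr] at hc
      rw [hc]
      refine neg_mem ⟨_, (sum_smul_restrictFamily b hθ fun x => c (Sum.inr x)).symm⟩) k
  exact ((hD.isDetGcd (span_sumElim_restrictFamily b hθ h2 hv)).associated key).trans
    (hass.mul_left _)

end OrderExtension

/-! ### Additive maps of modules over Laurent polynomials -/

section LaurentModule

open LaurentPolynomial

/-- Compatibility with T forces compatibility with its inverse. Two ring maps are allowed so that it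
covers both `substPow` and `evalOne`. -/
theorem map_laurent_smul {S₁ S₂ A H : Type*} [CommRing S₁] [CommRing S₂] [AddCommGroup A]
    [AddCommGroup H] [Module S₁ H] [Module S₂ A] (α : ℤ[T;T⁻¹] →+* S₁) (β : ℤ[T;T⁻¹] →+* S₂)
    (θ : H →+ A) (hθ : ∀ h, θ (α (T 1) • h) = β (T 1) • θ h) (f : ℤ[T;T⁻¹]) (h : H) :
    θ (α f • h) = β f • θ h := by
  have hneg : ∀ h, θ (α (T (-1)) • h) = β (T (-1)) • θ h := by
    intro h
    have := hθ (α (T (-1)) • h)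
    rw [smul_smul, ← map_mul, ← T_add, add_neg_cancel, T_zero, map_one, one_smul] at this
    rw [this, smul_smul, ← map_mul, ← T_add, neg_add_cancel, T_zero, map_one, one_smul]
  induction f using LaurentPolynomial.induction_on generalizing h with
  | h_C a =>
    have : (C a : ℤ[T;T⁻¹]) = (a : ℤ[T;T⁻¹]) := eq_intCast C a
    rw [this, map_intCast, map_intCast, Int.cast_smul_eq_zsmul, Int.cast_smul_eq_zsmul, map_zsmul]
  | h_add hp hq => rw [map_add, add_smul, map_add, hp, hq, map_add, add_smul]
  | h_C_mul_T n a ih =>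
    rw [T_add, ← mul_assoc, map_mul α, map_mul β, mul_smul, ih, hθ, ← mul_smul]
  | h_C_mul_T_Z n a ih =>
    rw [sub_eq_add_neg, T_add, ← mul_assoc, map_mul α, map_mul β, mul_smul, ih, hneg, ← mul_smul]

/-- The augmentation `f ↦ f(1)`. -/
def evalOne : ℤ[T;T⁻¹] →+* ℤ := LaurentPolynomial.eval₂ (RingHom.id ℤ) 1

theorem T_one_sub_one_dvd {f : ℤ[T;T⁻¹]} (hf : evalOne f = 0) : T 1 - 1 ∣ f := by
  obtain ⟨n, g, hg⟩ := exists_T_pow f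
  have h1 : g.eval 1 = 0 := by
    have := congrArg evalOne hg
    rw [map_mul, hf, zero_mul] at this
    simpa [evalOne, Polynomial.eval₂_eq_eval_map] using this
  obtain ⟨q, hq⟩ := Polynomial.dvd_iff_isRoot.2 h1
  have : T 1 - 1 ∣ f * T n := by
    rw [← hg, hq, map_mul]
    exact ⟨Polynomial.toLaurent q, by simp⟩
  exact (isUnit_T n).dvd_mul_right.1 this

/-- Additive maps on free modules over the Laurent polynomials are determined by their values on
the monomials. -/
theorem addHom_ext_single {κ A : Type*} [Finite κ] [DecidableEq κ] [AddCommGroup A]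
    {f g : (κ → ℤ[T;T⁻¹]) →+ A} (h : ∀ k n, f (Pi.single k (T n)) = g (Pi.single k (T n))) :
    f = g := by
  refine AddMonoidHom.functions_ext' _ _ _ fun k => ?_
  refine AddMonoidHom.ext fun q => ?_
  induction q using LaurentPolynomial.induction_on' with
  | add p q hp hq => rw [map_add, hp, hq, map_add]
  | C_mul_T n a =>
    have : (C a * T n : ℤ[T;T⁻¹]) = a • T n := (smul_eq_C_mul a _).symm
    rw [this, map_zsmul, map_zsmul]
    exact congrArg (a • ·) (h k n)

/-- The additive map with given values on the monomials. -/
def monomialLift {κ A : Type*} [Fintype κ] [AddCommGroup A] (F : κ → ℤ → A) :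
    (κ → ℤ[T;T⁻¹]) →+ A :=
  ∑ k, ((Finsupp.linearCombination ℤ (F k)).toAddMonoidHom.comp
    (AddMonoidAlgebra.coeffAddEquiv : ℤ[T;T⁻¹] ≃+ (ℤ →₀ ℤ)).toAddMonoidHom).comp
      (Pi.evalAddMonoidHom (fun _ : κ => ℤ[T;T⁻¹]) k)

theorem monomialLift_single {κ A : Type*} [Fintype κ] [DecidableEq κ] [AddCommGroup A]
    (F : κ → ℤ → A) (k : κ) (n : ℤ) : monomialLift F (Pi.single k (T n)) = F k n := by
  rw [monomialLift, AddMonoidHom.finsetSum_apply, Finset.sum_eq_single k]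
  · change Finsupp.linearCombination ℤ (F k)
      (Pi.single (M := fun _ => ℤ[T;T⁻¹]) k (T n) k).coeff = F k n
    rw [Pi.single_eq_same]
    exact (Finsupp.linearCombination_single ℤ 1 n).trans (one_smul _ _)
  · intro j _ hj
    simp [Pi.single_eq_of_ne hj]
  · simp

end LaurentModule

/-! ### The abelianized Crowell group -/

section Crowell

variable {K : Type*} [Group K] {N : ℕ} (ρ : K →* SymR N)

/-- The abelianized Crowell group, written additively. -/
abbrev CrowellAb : Type _ := Additive (Abelianization (CrowellGroup ρ))

/-- The class of the generator `ⁱu`. -/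
def crowellSymbol (i : Fin N) (u : K) : CrowellAb ρ :=
  Additive.ofMul (Abelianization.of (PresentedGroup.of (i, u)))

theorem crowellSymbol_mul (i : Fin N) (u v : K) : crowellSymbol ρ i (u * v) =
    crowellSymbol ρ i u + crowellSymbol ρ (SymR.act i (ρ u)) v := by
  have h : (PresentedGroup.of (i, u * v) : CrowellGroup ρ) =
      PresentedGroup.of (i, u) * PresentedGroup.of (SymR.act i (ρ u), v) := by
    have : PresentedGroup.mk (crowellRels ρ) (FreeGroup.of (i, u * v) *
        (FreeGroup.of (i, u) * FreeGroup.of (SymR.act i (ρ u), v))⁻¹) = 1 :=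
      PresentedGroup.one_of_mem ⟨i, u, v, rfl⟩
    rw [map_mul, map_inv, mul_inv_eq_one, map_mul] at this
    exact this
  rw [crowellSymbol, h, map_mul]
  rfl

variable {ρ} in
theorem crowellAb_hom_ext {A : Type*} [AddCommGroup A] {f g : CrowellAb ρ →+ A}
    (h : ∀ i u, f (crowellSymbol ρ i u) = g (crowellSymbol ρ i u)) : f = g := by
  apply AddMonoidHom.toMultiplicative.injective
  apply Abelianization.hom_ext
  apply PresentedGroup.ext
  rintro ⟨i, u⟩
  exact congrArg Multiplicative.ofAdd (h i u)

theorem exists_crowellAb_lift {A : Type*} [AddCommGroup A] (F : Fin N → K → A)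
    (hF : ∀ i u v, F i (u * v) = F i u + F (SymR.act i (ρ u)) v) :
    ∃ f : CrowellAb ρ →+ A, ∀ i u, f (crowellSymbol ρ i u) = F i u := by
  let f₀ : CrowellGroup ρ →* Multiplicative A :=
    PresentedGroup.toGroup (f := fun p : Fin N × K => Multiplicative.ofAdd (F p.1 p.2)) (by
      rintro _ ⟨i, u, v, rfl⟩
      rw [map_mul, map_inv, mul_inv_eq_one, map_mul]
      simp [hF])
  refine ⟨AddMonoidHom.toMultiplicative.symm (Abelianization.lift f₀), fun i u => ?_⟩
  change Multiplicative.toAdd (Abelianization.lift f₀ (Abelianization.of _)) = _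
  rw [Abelianization.lift_apply_of]
  simp [f₀]

theorem crowellAut_symbol (α : MulAut K) (h : ∀ u, ρ (α u) = ρ u) (i : Fin N) (u : K) :
    MulEquiv.toAdditive (crowellAut ρ α h).abelianizationCongr (crowellSymbol ρ i u) =
      crowellSymbol ρ i (α u) := by
  change Additive.ofMul ((crowellAut ρ α h).abelianizationCongr (Abelianization.of _)) = _
  rw [abelianizationCongr_of]
  exact congrArg (fun x => Additive.ofMul (Abelianization.of x)) (crowellMap_of ρ α h i u)

end Crowell

/-! ### Comparison with the chains of the cover -/

section Comparison

variable {G : Type*} [Group G] (𝒢 : AugmentedGroup G) {N : ℕ} (P : FinPresentation G)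
  (ρ : 𝒢.K →* SymR N) (ρG : G →* SymR N)

theorem act_mul (i : Fin N) (σ τ : SymR N) : SymR.act i (σ * τ) = SymR.act (SymR.act i σ) τ := by
  simp [SymR.act]

theorem act_one (i : Fin N) : SymR.act i 1 = i := by
  simp [SymR.act]

/-- The sheet of the vertex over `0` from which the path `x ^ ν` leads to the vertex `v`. -/
def baseSheet (v : ℤ × Fin N) : Fin N := SymR.act v.2 (ρG 𝒢.x ^ (-v.1))

/-- The loop `x ^ ν g x ^ (-ν - ε g)`. -/
def closedUp (ν : ℤ) (g : G) : 𝒢.K :=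
  ⟨𝒢.x ^ ν * g * 𝒢.x ^ (-(ν + Multiplicative.toAdd (𝒢.ε g))), by
    rw [MonoidHom.mem_ker, map_mul, map_mul, map_zpow, map_zpow, 𝒢.ε_x]
    apply Multiplicative.toAdd.injective
    simp⟩

variable {𝒢} in
theorem coe_closedUp (ν : ℤ) (g : G) : (closedUp 𝒢 ν g : G) =
    𝒢.x ^ ν * g * 𝒢.x ^ (-(ν + Multiplicative.toAdd (𝒢.ε g))) := rfl

theorem closedUp_mul (ν : ℤ) (g h : G) : closedUp 𝒢 ν (g * h) =
    closedUp 𝒢 ν g * closedUp 𝒢 (ν + Multiplicative.toAdd (𝒢.ε g)) h := by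
  apply Subtype.ext
  rw [Subgroup.coe_mul, coe_closedUp, coe_closedUp, coe_closedUp, map_mul, toAdd_mul]
  rw [← add_assoc]
  group

theorem closedUp_zero (u : 𝒢.K) : closedUp 𝒢 0 (u : G) = u := by
  apply Subtype.ext
  have : 𝒢.ε (u : G) = 1 := u.2
  simp [coe_closedUp, this]

theorem fibreAct_x_zpow (v : ℤ × Fin N) :
    fibreAct 𝒢 ρG (0, baseSheet 𝒢 ρG v) (𝒢.x ^ v.1) = v := by
  ext
  · simp [fibreAct, 𝒢.ε_x]
  · simp [fibreAct, baseSheet, ← act_mul, act_one]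

variable {ρ ρG}

theorem act_closedUp (hext : ∀ u : 𝒢.K, ρG (u : G) = ρ u) (v : ℤ × Fin N) (g : G) :
    SymR.act (baseSheet 𝒢 ρG v) (ρ (closedUp 𝒢 v.1 g)) = baseSheet 𝒢 ρG (fibreAct 𝒢 ρG v g) := by
  rw [← hext, coe_closedUp, map_mul, map_mul, map_zpow, map_zpow, baseSheet, baseSheet, fibreAct,
    ← act_mul, ← act_mul, zpow_neg (ρG 𝒢.x) v.1, mul_assoc, inv_mul_cancel_left]

/-- The class in the abelianized Crowell group of the lift of `g` starting at `v`. -/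
def liftClass (ρ : 𝒢.K →* SymR N) (ρG : G →* SymR N) (v : ℤ × Fin N) (g : G) : CrowellAb ρ :=
  crowellSymbol ρ (baseSheet 𝒢 ρG v) (closedUp 𝒢 v.1 g)

theorem liftClass_mul (hext : ∀ u : 𝒢.K, ρG (u : G) = ρ u) (v : ℤ × Fin N) (g h : G) :
    liftClass 𝒢 ρ ρG v (g * h) =
      liftClass 𝒢 ρ ρG v g + liftClass 𝒢 ρ ρG (fibreAct 𝒢 ρG v g) h := by
  rw [liftClass, closedUp_mul, crowellSymbol_mul, act_closedUp 𝒢 hext]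
  rfl

theorem liftClass_one (hext : ∀ u : 𝒢.K, ρG (u : G) = ρ u) (v : ℤ × Fin N) :
    liftClass 𝒢 ρ ρG v 1 = 0 := by
  have := liftClass_mul 𝒢 hext v 1 1
  rw [mul_one, fibreAct_one] at this
  simpa using this

theorem liftClass_zero (i : Fin N) (u : 𝒢.K) :
    liftClass 𝒢 ρ ρG (0, i) (u : G) = crowellSymbol ρ i u := by
  rw [liftClass, closedUp_zero, baseSheet]
  simp [act_one]

/-- Moving up r levels conjugates the closed-up loop by x^r, which is μ^r, and leaves the base sheet
alone since x^r acts trivially. This is why s corresponds to t^r. -/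
theorem liftClass_add_period {r : ℕ} (hper : ∀ u : 𝒢.K, ρ ((𝒢.μ ^ r) u) = ρ u)
    (hperG : ρG 𝒢.x ^ r = 1) (v : ℤ × Fin N) (g : G) :
    liftClass 𝒢 ρ ρG (v.1 + r, v.2) g =
      MulEquiv.toAdditive (crowellAut ρ (𝒢.μ ^ r) hper).abelianizationCongr
        (liftClass 𝒢 ρ ρG v g) := by
  rw [liftClass, liftClass, crowellAut_symbol]
  congr 1
  · simp only [baseSheet, neg_add, zpow_add, zpow_neg _ (r : ℤ), zpow_natCast, hperG]
    simp
  · have hμ : ∀ (n : ℕ) (u : 𝒢.K), (((𝒢.μ ^ n) u : 𝒢.K) : G) = 𝒢.x ^ n * u * (𝒢.x ^ n)⁻¹ := by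
      intro n u
      have : 𝒢.μ ^ n = MulAut.conjNormal (𝒢.x ^ n) := (map_pow _ _ _).symm
      rw [this, MulAut.conjNormal_apply]
    apply Subtype.ext
    rw [hμ, coe_closedUp, coe_closedUp, ← zpow_natCast]
    group

variable (ρ ρG)

/-- The additive map from the 1-chains of the cover to the abelianized Crowell group. -/
def chainClass : Chain1 P N →+ CrowellAb ρ :=
  monomialLift fun p ν => liftClass 𝒢 ρ ρG (ν, p.2) (P.proj (FreeGroup.of p.1))

theorem chainClass_edge (a : Fin P.n) (v : ℤ × Fin N) : chainClass 𝒢 P ρ ρG (edge P a v) =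
    liftClass 𝒢 ρ ρG v (P.proj (FreeGroup.of a)) :=
  monomialLift_single _ _ _

variable {P} in
theorem chain1_hom_ext {A : Type*} [AddCommGroup A] {f g : Chain1 P N →+ A}
    (h : ∀ a v, f (edge P a v) = g (edge P a v)) : f = g :=
  addHom_ext_single fun k n => h k.1 (n, k.2)

theorem mk_cons_true {α : Type*} (a : α) (w : List (α × Bool)) :
    FreeGroup.mk ((a, true) :: w) = FreeGroup.of a * FreeGroup.mk w := rfl

theorem mk_cons_false {α : Type*} (a : α) (w : List (α × Bool)) :
    FreeGroup.mk ((a, false) :: w) = (FreeGroup.of a)⁻¹ * FreeGroup.mk w := rfl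

/-- A cocycle on the fibre takes the value of the path chain on words. -/
theorem map_pathChain {A : Type*} [AddCommGroup A] (f : Chain1 P N →+ A) (F : ℤ × Fin N → G → A)
    (hF : ∀ v g h, F v (g * h) = F v g + F (fibreAct 𝒢 ρG v g) h)
    (hf : ∀ a v, f (edge P a v) = F v (P.proj (FreeGroup.of a))) (w : List (Fin P.n × Bool))
    (v : ℤ × Fin N) : f (pathChain 𝒢 P ρG w v) = F v (P.proj (FreeGroup.mk w)) := by
  have hF1 : ∀ v, F v 1 = 0 := fun v => by
    have := hF v 1 1
    rw [mul_one, fibreAct_one] at this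
    simpa using this
  induction w generalizing v with
  | nil => rw [pathChain, map_zero, ← FreeGroup.one_eq_mk, map_one, hF1]
  | cons c w ih =>
    obtain ⟨a, _ | _⟩ := c
    · rw [pathChain, map_add, map_neg, hf, ih, mk_cons_false, map_mul, hF, map_inv]
      congr 1
      have := hF v (P.proj (FreeGroup.of a))⁻¹ (P.proj (FreeGroup.of a))
      rw [inv_mul_cancel, hF1] at this
      exact (eq_neg_of_add_eq_zero_left this.symm).symm
    · rw [pathChain, map_add, hf, ih, mk_cons_true, map_mul, hF]

theorem T_smul_edge (n : ℤ) (a : Fin P.n) (v : ℤ × Fin N) :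
    (LaurentPolynomial.T n : ℤ[T;T⁻¹]) • edge P a v = edge P a (v.1 + n, v.2) := by
  rw [edge, edge, ← Pi.single_smul, smul_eq_mul, ← LaurentPolynomial.T_add, add_comm]

theorem T_smul_pathChain (n : ℤ) (w : List (Fin P.n × Bool)) (v : ℤ × Fin N) :
    (LaurentPolynomial.T n : ℤ[T;T⁻¹]) • pathChain 𝒢 P ρG w v =
      pathChain 𝒢 P ρG w (v.1 + n, v.2) := by
  have hact : ∀ (v : ℤ × Fin N) g, fibreAct 𝒢 ρG (v.1 + n, v.2) g =
      ((fibreAct 𝒢 ρG v g).1 + n, (fibreAct 𝒢 ρG v g).2) := fun v g => by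
    simp [fibreAct, add_right_comm]
  induction w generalizing v with
  | nil => simp [pathChain]
  | cons c w ih =>
    obtain ⟨a, _ | _⟩ := c
    · rw [pathChain, pathChain, smul_add, smul_neg, T_smul_edge, ih, hact]
    · rw [pathChain, pathChain, smul_add, T_smul_edge, ih, hact]

theorem boundary2_single (k : Fin P.m) (v : ℤ × Fin N) :
    boundary2 𝒢 P ρG (Pi.single (k, v.2) (LaurentPolynomial.T v.1)) =
      pathChain 𝒢 P ρG (P.rel k).toWord v := by
  rw [boundary2, Fintype.linearCombination_apply_single, T_smul_pathChain]
  simp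

theorem proj_rel (k : Fin P.m) : P.proj (P.rel k) = 1 := by
  rw [← MonoidHom.mem_ker, P.ker_eq]
  exact Subgroup.subset_normalClosure ⟨k, rfl⟩

variable {ρ ρG}

theorem chainClass_pathChain (hext : ∀ u : 𝒢.K, ρG (u : G) = ρ u) (w : List (Fin P.n × Bool))
    (v : ℤ × Fin N) : chainClass 𝒢 P ρ ρG (pathChain 𝒢 P ρG w v) =
      liftClass 𝒢 ρ ρG v (P.proj (FreeGroup.mk w)) :=
  map_pathChain 𝒢 P ρG _ _ (liftClass_mul 𝒢 hext) (chainClass_edge 𝒢 P ρ ρG) w v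

theorem chainClass_boundary2 (hext : ∀ u : 𝒢.K, ρG (u : G) = ρ u) (c : Chain2 P N) :
    chainClass 𝒢 P ρ ρG (boundary2 𝒢 P ρG c) = 0 := by
  have : (chainClass 𝒢 P ρ ρG).comp (boundary2 𝒢 P ρG).toAddMonoidHom = 0 :=
    addHom_ext_single fun k n => by
      change chainClass 𝒢 P ρ ρG (boundary2 𝒢 P ρG _) = 0
      rw [boundary2_single 𝒢 P ρG k.1 (n, k.2), chainClass_pathChain 𝒢 P hext,
        FreeGroup.mk_toWord, proj_rel, liftClass_one 𝒢 hext]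
  exact DFunLike.congr_fun this c

theorem chainClass_T_smul (r : ℕ) (hper : ∀ u : 𝒢.K, ρ ((𝒢.μ ^ r) u) = ρ u)
    (hperG : ρG 𝒢.x ^ r = 1) (c : Chain1 P N) :
    chainClass 𝒢 P ρ ρG ((LaurentPolynomial.T r : ℤ[T;T⁻¹]) • c) =
      MulEquiv.toAdditive (crowellAut ρ (𝒢.μ ^ r) hper).abelianizationCongr
        (chainClass 𝒢 P ρ ρG c) := by
  let lhs : Chain1 P N →+ CrowellAb ρ := (chainClass 𝒢 P ρ ρG).comp
    (DistribSMul.toAddMonoidHom (Chain1 P N) (LaurentPolynomial.T r : ℤ[T;T⁻¹]))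
  let rhs : Chain1 P N →+ CrowellAb ρ :=
    (MulEquiv.toAdditive (crowellAut ρ (𝒢.μ ^ r) hper).abelianizationCongr).toAddMonoidHom.comp
      (chainClass 𝒢 P ρ ρG)
  have : lhs = rhs := chain1_hom_ext fun a v => by
    change chainClass 𝒢 P ρ ρG ((LaurentPolynomial.T r : ℤ[T;T⁻¹]) • edge P a v) =
      MulEquiv.toAdditive _ (chainClass 𝒢 P ρ ρG (edge P a v))
    rw [T_smul_edge, chainClass_edge, chainClass_edge, ← liftClass_add_period 𝒢 hper hperG]
  exact DFunLike.congr_fun this c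

end Comparison

/-! ### Lifted paths modulo boundaries depend only on the element of G -/

section PathClass

variable {G : Type*} [Group G] (𝒢 : AugmentedGroup G) {N : ℕ} (P : FinPresentation G)
  (ρG : G →* SymR N)

/-- The 1-chains of the cover modulo the boundaries. -/
abbrev ChainQuot : Type := Chain1 P N ⧸ LinearMap.range (boundary2 𝒢 P ρG)

/-- The class of a 1-chain modulo boundaries. -/
def toQuot : Chain1 P N →+ ChainQuot 𝒢 P ρG :=
  (LinearMap.range (boundary2 𝒢 P ρG)).mkQ.toAddMonoidHom

theorem toQuot_eq_zero {c : Chain1 P N} :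
    toQuot 𝒢 P ρG c = 0 ↔ c ∈ LinearMap.range (boundary2 𝒢 P ρG) :=
  Submodule.Quotient.mk_eq_zero _

theorem toQuot_surjective : Function.Surjective (toQuot 𝒢 P ρG) :=
  Submodule.mkQ_surjective _

theorem pathChain_append (w w' : List (Fin P.n × Bool)) (v : ℤ × Fin N) :
    pathChain 𝒢 P ρG (w ++ w') v = pathChain 𝒢 P ρG w v +
      pathChain 𝒢 P ρG w' (fibreAct 𝒢 ρG v (P.proj (FreeGroup.mk w))) := by
  induction w generalizing v with
  | nil => simp [pathChain, ← FreeGroup.one_eq_mk, fibreAct_one]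
  | cons c w ih =>
    obtain ⟨a, _ | _⟩ := c
    · rw [List.cons_append, pathChain, pathChain, ih, mk_cons_false, map_mul, fibreAct_mul,
        map_inv, add_assoc]
    · rw [List.cons_append, pathChain, pathChain, ih, mk_cons_true, map_mul, fibreAct_mul,
        add_assoc]

/-- The permutation of the pairs of a vertex and a chain class that follows the edge of a
generator. -/
def edgePerm (a : Fin P.n) : Equiv.Perm ((ℤ × Fin N) × ChainQuot 𝒢 P ρG) where
  toFun q := (fibreAct 𝒢 ρG q.1 (P.proj (FreeGroup.of a)), q.2 + toQuot 𝒢 P ρG (edge P a q.1))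
  invFun q := (fibreAct 𝒢 ρG q.1 (P.proj (FreeGroup.of a))⁻¹,
    q.2 - toQuot 𝒢 P ρG (edge P a (fibreAct 𝒢 ρG q.1 (P.proj (FreeGroup.of a))⁻¹)))
  left_inv q := by simp [← fibreAct_mul, fibreAct_one]
  right_inv q := by simp [← fibreAct_mul, fibreAct_one]

/-- The action of the free group by following paths. -/
def pathPerm : FreeGroup (Fin P.n) →* (Equiv.Perm ((ℤ × Fin N) × ChainQuot 𝒢 P ρG))ᵐᵒᵖ :=
  FreeGroup.lift fun a => MulOpposite.op (edgePerm 𝒢 P ρG a)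

theorem pathPerm_mk (w : List (Fin P.n × Bool)) (q : (ℤ × Fin N) × ChainQuot 𝒢 P ρG) :
    (pathPerm 𝒢 P ρG (FreeGroup.mk w)).unop q =
      (fibreAct 𝒢 ρG q.1 (P.proj (FreeGroup.mk w)),
        q.2 + toQuot 𝒢 P ρG (pathChain 𝒢 P ρG w q.1)) := by
  induction w generalizing q with
  | nil => simp [pathChain, ← FreeGroup.one_eq_mk, fibreAct_one]
  | cons c w ih =>
    obtain ⟨a, _ | _⟩ := c
    · rw [mk_cons_false, map_mul, MulOpposite.unop_mul, Equiv.Perm.mul_apply, ih, pathChain,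
        map_mul, fibreAct_mul, map_add, map_neg, map_inv, map_inv, pathPerm, FreeGroup.lift_apply_of,
        ← MulOpposite.op_inv, MulOpposite.unop_op, ← add_assoc, ← sub_eq_add_neg]
      rfl
    · rw [mk_cons_true, map_mul, MulOpposite.unop_mul, Equiv.Perm.mul_apply, ih, pathChain,
        map_mul, fibreAct_mul, map_add, pathPerm, FreeGroup.lift_apply_of, MulOpposite.unop_op,
        ← add_assoc]
      rfl

/-- The free group acts on pairs (vertex, chain class) by following paths. Relators lift to
boundaries and so act trivially; hence their normal closure does too, and no normal form for its
elements is needed. -/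
theorem toQuot_pathChain_congr {w w' : List (Fin P.n × Bool)}
    (h : P.proj (FreeGroup.mk w) = P.proj (FreeGroup.mk w')) (v : ℤ × Fin N) :
    toQuot 𝒢 P ρG (pathChain 𝒢 P ρG w v) = toQuot 𝒢 P ρG (pathChain 𝒢 P ρG w' v) := by
  have hker : P.proj.ker ≤ (pathPerm 𝒢 P ρG).ker := by
    rw [P.ker_eq]
    refine Subgroup.normalClosure_le_normal ?_
    rintro _ ⟨k, rfl⟩
    apply MulOpposite.unop_injective
    ext1 q
    rw [← FreeGroup.mk_toWord (x := P.rel k), pathPerm_mk, FreeGroup.mk_toWord, proj_rel,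
      fibreAct_one, (toQuot_eq_zero 𝒢 P ρG).2 ⟨_, boundary2_single 𝒢 P ρG k q.1⟩, add_zero]
    rfl
  have h1 : pathPerm 𝒢 P ρG (FreeGroup.mk w) = pathPerm 𝒢 P ρG (FreeGroup.mk w') := by
    rw [← inv_mul_eq_one, ← map_inv, ← map_mul]
    apply hker
    rw [MonoidHom.mem_ker, map_mul, map_inv, h, inv_mul_cancel]
  have h2 := congrArg (fun σ => (σ.unop (v, 0)).2) h1
  simpa only [pathPerm_mk, zero_add] using h2

/-- The class modulo boundaries of the lifts of an element of `G` is well defined. -/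
theorem exists_pathClass : ∃ ω : ℤ × Fin N → G → ChainQuot 𝒢 P ρG,
    (∀ v g h, ω v (g * h) = ω v g + ω (fibreAct 𝒢 ρG v g) h) ∧
      ∀ w v, ω v (P.proj (FreeGroup.mk w)) = toQuot 𝒢 P ρG (pathChain 𝒢 P ρG w v) := by
  have hw : ∀ g, ∃ w, P.proj (FreeGroup.mk w) = g := fun g => by
    obtain ⟨y, rfl⟩ := P.surj g
    exact ⟨y.toWord, by rw [FreeGroup.mk_toWord]⟩
  choose W hW using hw
  refine ⟨fun v g => toQuot 𝒢 P ρG (pathChain 𝒢 P ρG (W g) v), fun v g h => ?_,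
    fun w v => toQuot_pathChain_congr 𝒢 P ρG (hW _) v⟩
  have : P.proj (FreeGroup.mk (W (g * h))) = P.proj (FreeGroup.mk (W g ++ W h)) := by
    rw [← FreeGroup.mul_mk, map_mul, hW, hW, hW]
  refine (toQuot_pathChain_congr 𝒢 P ρG this v).trans ?_
  rw [pathChain_append, map_add, hW]

end PathClass

/-! ### The exact sequence relating H₁(X̂'), K_ρ^ab and ℤ^N -/

section Exactness

variable {G : Type*} [Group G] (𝒢 : AugmentedGroup G) {N : ℕ} (P : FinPresentation G)
  {ρ : 𝒢.K →* SymR N} {ρG : G →* SymR N}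

/-- The boundary map of the abelianized Crowell group. -/
theorem exists_crowellBoundary (ρ : 𝒢.K →* SymR N) : ∃ d : CrowellAb ρ →+ (Fin N → ℤ),
    ∀ i u, d (crowellSymbol ρ i u) = Pi.single (SymR.act i (ρ u)) 1 - Pi.single i 1 :=
  exists_crowellAb_lift ρ _ fun i u v => by
    rw [map_mul, act_mul]
    abel

/-- The map J sends ⁱu to the class of the lift of u at (0, i). It is a section of the chain class
map, and in the other order the composite differs from the identity by h ∘ ∂, which vanishes on
cycles. -/
theorem chainClass_exact (hext : ∀ u : 𝒢.K, ρG (u : G) = ρ u)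
    {d : CrowellAb ρ →+ (Fin N → ℤ)}
    (hd : ∀ i u, d (crowellSymbol ρ i u) = Pi.single (SymR.act i (ρ u)) 1 - Pi.single i 1) :
    (∀ c, boundary1 𝒢 P ρG c = 0 → chainClass 𝒢 P ρ ρG c = 0 →
      c ∈ LinearMap.range (boundary2 𝒢 P ρG)) ∧
    (∀ c, boundary1 𝒢 P ρG c = 0 → d (chainClass 𝒢 P ρ ρG c) = 0) ∧
    ∀ a, d a = 0 → ∃ c, boundary1 𝒢 P ρG c = 0 ∧ chainClass 𝒢 P ρ ρG c = a := by
  obtain ⟨ω, hω, hωw⟩ := exists_pathClass 𝒢 P ρG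
  obtain ⟨J, hJ⟩ := exists_crowellAb_lift ρ (fun i u => ω (0, i) (u : G)) fun i u v => by
    have : fibreAct 𝒢 ρG (0, i) (u : G) = (0, SymR.act i (ρ u)) := by
      have h1 : 𝒢.ε (u : G) = 1 := u.2
      simp [fibreAct, h1, hext]
    rw [Subgroup.coe_mul, hω, this]
  have hword : ∀ g, ∃ w, P.proj (FreeGroup.mk w) = g := fun g => by
    obtain ⟨y, rfl⟩ := P.surj g
    exact ⟨y.toWord, by rw [FreeGroup.mk_toWord]⟩
  have hedge : ∀ a v, ω v (P.proj (FreeGroup.of a)) = toQuot 𝒢 P ρG (edge P a v) := fun a v =>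
    (hωw [(a, true)] v).trans (by simp [pathChain])
  -- The homotopy h joins each vertex to level 0 by the lift of a power of x.
  let h : Chain0 N →+ ChainQuot 𝒢 P ρG :=
    monomialLift fun i ν => ω (0, baseSheet 𝒢 ρG (ν, i)) (𝒢.x ^ ν)
  have hvertex : ∀ v, h (vertex v) = ω (0, baseSheet 𝒢 ρG v) (𝒢.x ^ v.1) :=
    fun v => monomialLift_single _ _ _
  have hJlift : ∀ v g, J (liftClass 𝒢 ρ ρG v g) =
      ω v g - (h (vertex (fibreAct 𝒢 ρG v g)) - h (vertex v)) := by
    intro v g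
    have hε : (fibreAct 𝒢 ρG v g).1 = v.1 + Multiplicative.toAdd (𝒢.ε g) := rfl
    have h1 : (closedUp 𝒢 v.1 g : G) * 𝒢.x ^ (fibreAct 𝒢 ρG v g).1 = 𝒢.x ^ v.1 * g := by
      rw [coe_closedUp, hε, zpow_neg, inv_mul_cancel_right]
    have h2 := congrArg (ω (0, baseSheet 𝒢 ρG v)) h1
    have h3 : fibreAct 𝒢 ρG (0, baseSheet 𝒢 ρG v) (closedUp 𝒢 v.1 g : G) =
        (0, baseSheet 𝒢 ρG (fibreAct 𝒢 ρG v g)) := by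
      have h4 : 𝒢.ε (closedUp 𝒢 v.1 g : G) = 1 := (closedUp 𝒢 v.1 g).2
      rw [← act_closedUp 𝒢 hext]
      simp [fibreAct, h4, hext]
    rw [hω, hω, h3, fibreAct_x_zpow] at h2
    rw [liftClass, hJ, hvertex, hvertex, eq_sub_of_add_eq h2]
    abel
  have hJchain : ∀ c, J (chainClass 𝒢 P ρ ρG c) = toQuot 𝒢 P ρG c - h (boundary1 𝒢 P ρG c) := by
    intro c
    have : J.comp (chainClass 𝒢 P ρ ρG) =
        toQuot 𝒢 P ρG - h.comp (boundary1 𝒢 P ρG).toAddMonoidHom := chain1_hom_ext fun a v => by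
      change J (chainClass 𝒢 P ρ ρG (edge P a v)) =
        toQuot 𝒢 P ρG (edge P a v) - h (boundary1 𝒢 P ρG (edge P a v))
      rw [chainClass_edge, hJlift, hedge, boundary1_edge, map_sub]
    exact DFunLike.congr_fun this c
  refine ⟨fun c hc hc' => ?_, fun c hc => ?_, fun a ha => ?_⟩
  · have := hJchain c
    rw [hc, hc', map_zero, map_zero, sub_zero] at this
    exact (toQuot_eq_zero 𝒢 P ρG).1 this.symm
  -- Collapsing each vertex to its base sheet intertwines ∂ with d.
  · let k : Chain0 N →+ (Fin N → ℤ) :=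
      monomialLift fun i ν => Pi.single (baseSheet 𝒢 ρG (ν, i)) 1
    have hk : ∀ v, k (vertex v) = Pi.single (baseSheet 𝒢 ρG v) 1 :=
      fun v => monomialLift_single _ _ _
    have : d.comp (chainClass 𝒢 P ρ ρG) = k.comp (boundary1 𝒢 P ρG).toAddMonoidHom :=
      chain1_hom_ext fun a v => by
        change d (chainClass 𝒢 P ρ ρG (edge P a v)) = k (boundary1 𝒢 P ρG (edge P a v))
        rw [chainClass_edge, boundary1_edge, map_sub, hk, hk, liftClass, hd,
          act_closedUp 𝒢 hext]
    have h1 := DFunLike.congr_fun this c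
    refine h1.trans ?_
    change k (boundary1 𝒢 P ρG c) = 0
    rw [hc, map_zero]
  -- Any chain representing J a works: its boundary is d a placed at level 0, and its chain class is
  -- a.
  · obtain ⟨c, hc⟩ := toQuot_surjective 𝒢 P ρG (J a)
    let b : ChainQuot 𝒢 P ρG →+ Chain0 N := ((LinearMap.range (boundary2 𝒢 P ρG)).liftQ
      (boundary1 𝒢 P ρG) (by
        rintro _ ⟨y, rfl⟩
        exact boundary1_boundary2 𝒢 P ρG y)).toAddMonoidHom
    let χ : ChainQuot 𝒢 P ρG →+ CrowellAb ρ := QuotientAddGroup.lift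
      (LinearMap.range (boundary2 𝒢 P ρG)).toAddSubgroup (chainClass 𝒢 P ρ ρG) (by
        rintro _ ⟨y, rfl⟩
        exact chainClass_boundary2 𝒢 P hext y)
    have hb : ∀ c, b (toQuot 𝒢 P ρG c) = boundary1 𝒢 P ρG c := fun c => rfl
    have hχ : ∀ c, χ (toQuot 𝒢 P ρG c) = chainClass 𝒢 P ρ ρG c := fun c => rfl
    let e : (Fin N → ℤ) →+ Chain0 N := AddMonoidHom.compLeft
      (algebraMap ℤ ℤ[T;T⁻¹] : ℤ →+ ℤ[T;T⁻¹]) (Fin N)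
    have he : ∀ i, e (Pi.single i 1) = vertex (0, i) := by
      intro i
      ext1 j
      simp only [e, vertex, AddMonoidHom.compLeft_apply, Function.comp_apply]
      rcases eq_or_ne i j with rfl | hij
      · simp
      · simp [Pi.single_eq_of_ne hij.symm]
    have h1 : b.comp J = e.comp d := crowellAb_hom_ext fun i u => by
      obtain ⟨w, hw⟩ := hword (u : G)
      have hu : 𝒢.ε (u : G) = 1 := u.2
      change b (J _) = e (d _)
      rw [hJ, hd, map_sub, he, he, ← hw, hωw, hb, boundary1_pathChain, hw]
      simp [fibreAct, hu, hext]
    have h2 : χ.comp J = AddMonoidHom.id _ := crowellAb_hom_ext fun i u => by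
      obtain ⟨w, hw⟩ := hword (u : G)
      change χ (J _) = _
      rw [hJ, ← hw, hωw, hχ, chainClass_pathChain 𝒢 P hext, hw, liftClass_zero]
      rfl
    refine ⟨c, ?_, ?_⟩
    · rw [← hb, hc]
      refine (DFunLike.congr_fun h1 a).trans ?_
      change e (d a) = 0
      rw [ha, map_zero]
    · rw [← hχ, hc]
      exact DFunLike.congr_fun h2 a

end Exactness

/-! ### Module structures on the exact sequence -/

section Assembly

open LaurentPolynomial

variable {G : Type*} [Group G] (𝒢 : AugmentedGroup G) (P : FinPresentation G) {r : ℕ}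

instance {N : ℕ} (ρG : G →* SymR N) : Module (LaurentRoot r) (CoverH1 𝒢 P ρG) :=
  inferInstanceAs (Module ℤ[T;T⁻¹] (CoverH1 𝒢 P ρG))

/-- The homology of the cover embeds in the Crowell module as the kernel of the boundary map. -/
theorem exists_coverH1_embedding {N : ℕ} {ρ : 𝒢.K →* SymR N} {ρG : G →* SymR N}
    (hper : ∀ u : 𝒢.K, ρ ((𝒢.μ ^ r) u) = ρ u) (hext : ∀ u : 𝒢.K, ρG (u : G) = ρ u)
    (hperG : ρG 𝒢.x ^ r = 1) {d : CrowellAb ρ →+ (Fin N → ℤ)}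
    (hd : ∀ i u, d (crowellSymbol ρ i u) = Pi.single (SymR.act i (ρ u)) 1 - Pi.single i 1) :
    ∃ θ : CoverH1 𝒢 P ρG →+ CrowellModule 𝒢 ρ r hper, Function.Injective θ ∧
      (∀ f h, θ (substPow r f • h) = f • θ h) ∧ ∀ a, a ∈ θ.range ↔ d a = 0 := by
  obtain ⟨h1, h2, h3⟩ := chainClass_exact 𝒢 P hext hd
  let θ : CoverH1 𝒢 P ρG →+ CrowellModule 𝒢 ρ r hper :=
    QuotientAddGroup.lift
      ((LinearMap.range (boundary2 𝒢 P ρG)).submoduleOf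
        (LinearMap.ker (boundary1 𝒢 P ρG))).toAddSubgroup
      ((chainClass 𝒢 P ρ ρG).comp (LinearMap.ker (boundary1 𝒢 P ρG)).subtype.toAddMonoidHom) (by
        rintro c ⟨y, hy⟩
        change chainClass 𝒢 P ρ ρG (c : Chain1 P N) = 0
        have hy : boundary2 𝒢 P ρG y = (c : Chain1 P N) := hy
        rw [← hy, chainClass_boundary2 𝒢 P hext])
  have hθ : ∀ c : LinearMap.ker (boundary1 𝒢 P ρG), θ (Submodule.Quotient.mk c) =
      chainClass 𝒢 P ρ ρG (c : Chain1 P N) := fun c => rfl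
  refine ⟨θ, ?_, ?_, fun a => ⟨?_, fun ha => ?_⟩⟩
  · rw [injective_iff_map_eq_zero]
    intro h hh
    obtain ⟨c, rfl⟩ := Submodule.Quotient.mk_surjective _ h
    exact (Submodule.Quotient.mk_eq_zero _).2 (h1 c c.2 ((hθ c).symm.trans hh))
  · refine map_laurent_smul (substPow r) (RingHom.id _) θ fun h => ?_
    obtain ⟨c, rfl⟩ := Submodule.Quotient.mk_surjective _ h
    rw [substPow_T, mul_one]
    refine (chainClass_T_smul 𝒢 P r hper hperG c).trans ?_
    exact (laurentModule_T_smul _ _).symm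
  · rintro ⟨h, rfl⟩
    obtain ⟨c, rfl⟩ := Submodule.Quotient.mk_surjective _ h
    exact h2 c c.2
  · obtain ⟨c, hc, rfl⟩ := h3 a ha
    exact ⟨Submodule.Quotient.mk ⟨c, hc⟩, rfl⟩

/-- Since ρ is unchanged by μ^r, the boundary is invariant under s, so scalars act on it through
their value at s = 1. -/
theorem boundary_smul {N : ℕ} {ρ : 𝒢.K →* SymR N} (hper : ∀ u : 𝒢.K, ρ ((𝒢.μ ^ r) u) = ρ u)
    {d : CrowellAb ρ →+ (Fin N → ℤ)}
    (hd : ∀ i u, d (crowellSymbol ρ i u) = Pi.single (SymR.act i (ρ u)) 1 - Pi.single i 1)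
    (f : ℤ[T;T⁻¹]) (a : CrowellModule 𝒢 ρ r hper) : d (f • a) = evalOne f • d a := by
  refine map_laurent_smul (RingHom.id _) evalOne (H := CrowellModule 𝒢 ρ r hper) d (fun a => ?_) f a
  have h1 : evalOne (T 1) = 1 := by simp [evalOne]
  have h2 : d.comp (MulEquiv.toAdditive
      (crowellAut ρ (𝒢.μ ^ r) hper).abelianizationCongr).toAddMonoidHom = d :=
    crowellAb_hom_ext fun i u => by
      change d (MulEquiv.toAdditive _ (crowellSymbol ρ i u)) = _
      rw [crowellAut_symbol, hd, hd, hper]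
  rw [h1, one_smul, RingHom.id_apply]
  exact (congrArg d (laurentModule_T_smul _ a)).trans (DFunLike.congr_fun h2 a)

theorem evalOne_T_sub_one : evalOne (T 1 - 1) = 0 := by simp [evalOne]

/-- The family of elements of the Crowell module whose boundaries form a basis of the
augmentation kernel. -/
theorem exists_complement {n : ℕ} {ρ : 𝒢.K →* SymR (n + 1)}
    (htrans : ∀ i j : Fin (n + 1), ∃ u : 𝒢.K, SymR.act i (ρ u) = j)
    (hper : ∀ u : 𝒢.K, ρ ((𝒢.μ ^ r) u) = ρ u) {d : CrowellAb ρ →+ (Fin (n + 1) → ℤ)}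
    (hd : ∀ i u, d (crowellSymbol ρ i u) = Pi.single (SymR.act i (ρ u)) 1 - Pi.single i 1) :
    ∃ w : Fin n → CrowellModule 𝒢 ρ r hper,
      (∀ k, d ((T 1 - 1 : ℤ[T;T⁻¹]) • w k) = 0) ∧
      (∀ y : CrowellModule 𝒢 ρ r hper, ∃ c : Fin n → ℤ[T;T⁻¹], d (y - ∑ k, c k • w k) = 0) ∧
      ∀ c : Fin n → ℤ[T;T⁻¹], d (∑ k, c k • w k) = 0 → ∀ k, T 1 - 1 ∣ c k := by
  -- Loops from sheet 0 to each other sheet have boundaries [k+1] - [0], a basis of the vectors with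
  -- sum zero.
  choose u hu using fun k : Fin n => htrans 0 k.succ
  let w : Fin n → CrowellModule 𝒢 ρ r hper := fun k => crowellSymbol ρ 0 (u k)
  have hw : ∀ k, d (w k) = Pi.single k.succ 1 - Pi.single 0 1 := fun k => by
    rw [← hu k]
    exact hd 0 (u k)
  have hsum : ∀ c : Fin n → ℤ[T;T⁻¹], d (∑ k, c k • w k) =
      ∑ k, evalOne (c k) • (Pi.single k.succ 1 - Pi.single 0 1) := fun c =>
    (map_sum d _ _).trans (Finset.sum_congr rfl fun k _ => by rw [boundary_smul 𝒢 hper hd, hw])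
  have hsucc : ∀ (a : Fin n → ℤ) (j : Fin n), (∑ k, a k •
      (Pi.single k.succ 1 - Pi.single 0 1 : Fin (n + 1) → ℤ)) j.succ = a j := fun a j => by
    simp [Finset.sum_apply, Pi.single_apply]
  refine ⟨w, fun k => ?_, fun y => ⟨fun k => C (d y k.succ), ?_⟩, fun c hc k => ?_⟩
  · rw [boundary_smul 𝒢 hper hd, evalOne_T_sub_one, zero_smul]
  · let σ : (Fin (n + 1) → ℤ) →+ ℤ := ∑ i, Pi.evalAddMonoidHom (fun _ => ℤ) i
    have hσ : ∀ f, σ f = ∑ i, f i := fun f => by simp [σ]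
    have h0 : ∑ i, d y i = 0 := by
      have : σ.comp d = 0 := crowellAb_hom_ext fun i u => by
        change σ (d _) = 0
        rw [hd, map_sub, hσ, hσ, Finset.sum_pi_single', Finset.sum_pi_single']
        simp
      rw [← hσ]
      exact DFunLike.congr_fun this y
    have hev : ∀ a : ℤ, evalOne (C a) = a := fun a => by simp [evalOne]
    refine (map_sub d _ _).trans ?_
    refine sub_eq_zero.2 (Eq.trans ?_ (hsum fun k => C (d y k.succ)).symm)
    simp only [hev]
    ext i
    refine Fin.cases ?_ (fun j => (hsucc (fun k => d y k.succ) j).symm) i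
    rw [Fin.sum_univ_succ] at h0
    simp [Finset.sum_apply, eq_neg_of_add_eq_zero_left h0]
  · refine T_one_sub_one_dvd ?_
    rw [hsum] at hc
    rw [← hsucc (fun k => evalOne (c k)) k, hc]
    rfl

end Assembly

end TwistedAlexander

end

open TwistedAlexander LaurentPolynomial in
theorem mainTheorem10 {G : Type*} [Group G] (𝒢 : TwistedAlexander.AugmentedGroup G)
    (P : TwistedAlexander.FinPresentation G)
    (N : ℕ) (hN : 0 < N) (r : ℕ) (hr : 0 < r)
    (ρ : 𝒢.K →* TwistedAlexander.SymR N)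
    (htrans : ∀ i j : Fin N, ∃ u : 𝒢.K, TwistedAlexander.SymR.act i (ρ u) = j)
    (hper : ∀ u : 𝒢.K, ρ ((𝒢.μ ^ r) u) = ρ u)
    (ρG : G →* TwistedAlexander.SymR N)
    (hext : ∀ u : 𝒢.K, ρG (u : G) = ρ u)
    (hperG : ρG 𝒢.x ^ r = 1) :
    (∃ D : LaurentPolynomial ℤ, TwistedAlexander.IsOrder (LaurentPolynomial ℤ)
      (TwistedAlexander.CrowellModule 𝒢 ρ r hper) D) ∧
    (∃ Δ : Polynomial ℤ, TwistedAlexander.IsOrder (LaurentPolynomial ℤ)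
      (TwistedAlexander.CoverH1 𝒢 P ρG) (Polynomial.toLaurent Δ)) ∧
    ∀ (D : LaurentPolynomial ℤ) (Δ : Polynomial ℤ),
      TwistedAlexander.IsOrder (LaurentPolynomial ℤ)
        (TwistedAlexander.CrowellModule 𝒢 ρ r hper) D →
      TwistedAlexander.IsOrder (LaurentPolynomial ℤ)
        (TwistedAlexander.CoverH1 𝒢 P ρG) (Polynomial.toLaurent Δ) →
      ∃ F : Polynomial ℤ,
        F.map (Int.castRingHom ℂ) =
          TwistedAlexander.powRoots r (Δ.map (Int.castRingHom ℂ)) ∧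
        Associated D
          (Polynomial.toLaurent F * (LaurentPolynomial.T 1 - 1) ^ (N - 1)) := by
  obtain ⟨n, rfl⟩ := Nat.exists_eq_add_one.2 hN
  have : NeZero r := ⟨hr.ne'⟩
  obtain ⟨d, hd⟩ := exists_crowellBoundary 𝒢 ρ
  obtain ⟨θ, hinj, hθ, hrange⟩ := exists_coverH1_embedding 𝒢 P hper hext hperG hd
  obtain ⟨w, h1, h2, h3⟩ := exists_complement 𝒢 htrans hper hd
  -- `LaurentRoot r` is the ring in t, seen as an algebra over the ring in s.
  have hθ' : ∀ (f : ℤ[T;T⁻¹]) h, θ (algebraMap ℤ[T;T⁻¹] (LaurentRoot r) f • h) = f • θ h := hθ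
  have h1 : ∀ k, (LaurentPolynomial.T 1 - 1 : ℤ[T;T⁻¹]) • w k ∈ θ.range :=
    fun k => (hrange _).2 (h1 k)
  have h2 : ∀ y, ∃ c : Fin n → ℤ[T;T⁻¹], y - ∑ k, c k • w k ∈ θ.range :=
    fun y => (h2 y).imp fun c hc => (hrange _).2 hc
  have h3 : ∀ c : Fin n → ℤ[T;T⁻¹], ∑ k, c k • w k ∈ θ.range →
      ∀ k, LaurentPolynomial.T 1 - 1 ∣ c k :=
    fun c hc => h3 c ((hrange _).1 hc)
  have : Module.Finite (LaurentRoot r) (CoverH1 𝒢 P ρG) :=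
    inferInstanceAs (Module.Finite ℤ[T;T⁻¹] (CoverH1 𝒢 P ρG))
  refine ⟨?_, ?_, fun D Δ hD hΔ => ?_⟩
  · have := finite_of_extension (laurentRootBasis r) hθ' h2
    exact exists_isOrder
  · obtain ⟨δ, hδ⟩ := exists_isOrder (R := ℤ[T;T⁻¹]) (M := CoverH1 𝒢 P ρG)
    -- An order may be multiplied by the unit t^k to make it a polynomial.
    obtain ⟨k, Δ, hΔ⟩ := LaurentPolynomial.exists_T_pow δ
    exact ⟨Δ, hΔ ▸ hδ.associated (associated_mul_unit_right _ _ (LaurentPolynomial.isUnit_T _))⟩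
  · obtain ⟨F, hF, hFn⟩ := exists_map_eq_powRoots r Δ
    obtain ⟨p₀, hp₀⟩ := exists_prime_laurent
    refine ⟨F, hF, ?_⟩
    have key := IsOrder.associated_of_extension (laurentRootBasis r) hp₀ hinj hθ'
      T_one_sub_one_ne_zero h1 h2 h3 hD (Δ := (show LaurentRoot r from Polynomial.toLaurent Δ)) hΔ
    rw [Fintype.card_fin] at key
    rw [Nat.add_sub_cancel, mul_comm]
    exact key.trans (hFn.mul_left _)
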